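/- Let $\mathbb{K}$ be a field. An *$r$-degenerate symplectic space* over $\mathbb{K}$ is a finite-dimensional $\mathbb{K}$-vector space $V$ with a bilinear form $\Psi$ such that $\Psi(v,v)=0$ for all $v\in V$ and whose radical $\{v : \Psi(v,\cdot)=0\}$ has dimension $r$; it is a *symplectic space* if $r=0$. Its orthogonality graph $\mathcal{G}(V)$ has as vertices the $2$-dimensional subspaces of $V$ on which $\Psi$ is non-degenerate, two of them being adjacent if they are orthogonal. Its frame complex $\mathcal{F}(V)$ is the clique complex of $\mathcal{G}(V)$; topological statements about $\mathcal{F}(V)$ refer to its geometric realization. **Theorem.** Let $n\ge 2$ and let $V$ be a symplectic space of dimension $2n$ over $\mathbb{K}$. 1. $\mathcal{F}(V)$ is connected if and only if $n\ge 3$. 2. If $n=2$, then $\mathcal{F}(V)$ is homotopy-discrete, i.e. homotopy equivalent to a discrete space, with $|\mathbb{K}|^2(|\mathbb{K}|^2+1)/2$ connected components. (For infinite $\mathbb{K}$ this is cardinal arithmetic: twice the number of components is $|\mathbb{K}|^2(|\mathbb{K}|^2+1)$.) 3. If $n=3$, then $\mathcal{G}(V)$ has diameter $3$ and $\mathcal{F}(V)$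 is homotopy equivalent to a wedge of a non-empty family of $1$-spheres. If $\mathbb{K}=\mathrm{GF}(q)$ is finite, the number of these spheres is $$-\tilde\chi(\mathcal{F}(V)) = \tfrac13\left(q^{12}+2q^{10}-q^8-2q^6-3q^4+3\right),$$ where $\tilde\chi(\mathcal{F}(V))=\sum_{\sigma}(-1)^{|\sigma|-1}$ is the reduced Euler characteristic, the sum being over all simplices $\sigma$, including the empty one. 4. If $n\ge 4$, then $\mathcal{G}(V)$ has diameter $2$. Moreover, if $V'$ is an $r$-degenerate symplectic space over $\mathbb{K}$ of dimension $2n+r$ (with $n\ge 2$, $r\ge 0$), then $\mathcal{F}(V')$ is connected if and only if $n\ge 3$. -/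

import Mathlib

universe u v

noncomputable section

namespace SymplecticFrames

/-! ### Simplicial complexes: clique complex, geometric realization, Euler characteristic -/

/-- The clique complex of a simple graph: its simplices are the non-empty finite cliques. -/
def cliqueComplex {W : Type u} (G : SimpleGraph W) : AbstractSimplicialComplex W where
  faces := {s | s.Nonempty ∧ G.IsClique (s : Set W)}
  isRelLowerSet_faces := fun {_} hs =>
    ⟨hs.1, fun _ hts ht => ⟨ht, hs.2.subset (Finset.coe_subset.mpr hts)⟩⟩
  singleton_mem := fun w => ⟨Finset.singleton_nonempty w, by simp⟩

/-- The points of the geometric realization of an abstract simplicial complex, in barycentric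
coordinates: finitely supported non-negative weights of total mass one on the vertices, whose
support is a simplex. -/
@[ext]
structure Realization {W : Type u} (X : AbstractSimplicialComplex W) : Type u where
  /-- The barycentric coordinates. -/
  coord : W →₀ ℝ
  nonneg : ∀ w, 0 ≤ coord w
  sum_eq_one : (coord.sum fun _ a => a) = 1
  support_mem : coord.support ∈ X.faces

/-- The closed simplex of the realization spanned by a finite set of vertices. -/
def Realization.closedSimplex {W : Type u} (X : AbstractSimplicialComplex W) (s : Finset W) :
    Type u :=
  {x : Realization X // x.coord.support ⊆ s}

/-- A closed simplex carries its Euclidean topology, that is, the one given by the barycentric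
coordinates. -/
instance {W : Type u} (X : AbstractSimplicialComplex W) (s : Finset W) :
    TopologicalSpace (Realization.closedSimplex X s) :=
  TopologicalSpace.induced (fun x (w : W) => x.1.coord w) inferInstance

/-- The weak (CW) topology: a subset of the realization is open if and only if its intersection
with every closed simplex is open in that simplex. -/
instance {W : Type u} (X : AbstractSimplicialComplex W) : TopologicalSpace (Realization X) :=
  ⨆ s : X.faces, TopologicalSpace.coinduced
    (fun x : Realization.closedSimplex X s.1 => x.1) inferInstance

/-- The reduced Euler characteristic of a finite simplicial complex, the sum of `(-1) ^ (|s| - 1)`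
over all simplices `s` including the empty one, which contributes `-1`. -/
def reducedEulerChar {W : Type u} (X : AbstractSimplicialComplex W) : ℤ :=
  -1 + ∑ᶠ s ∈ X.faces, (-1 : ℤ) ^ (s.card + 1)

/-! ### Homotopy types -/

/-- A space is homotopy-discrete if it is homotopy equivalent to a discrete space. -/
def HomotopyDiscrete (X : Type u) [TopologicalSpace X] : Prop :=
  ∃ (D : Type u) (_ : TopologicalSpace D) (_ : DiscreteTopology D),
    Nonempty (ContinuousMap.HomotopyEquiv X D)

/-- The gluing relation of a wedge of circles: the extra point on the left is identified with the
base point `1` of every circle. -/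
inductive WedgeRel (ι : Type u) : Unit ⊕ (Σ _ : ι, Circle) → Unit ⊕ (Σ _ : ι, Circle) → Prop
  | glue (i : ι) : WedgeRel ι (Sum.inl ()) (Sum.inr ⟨i, 1⟩)

/-- The wedge of a family of `1`-spheres indexed by `ι`, with the quotient topology. -/
def WedgeOfCircles (ι : Type u) : Type u :=
  Quot (WedgeRel ι)

instance (ι : Type u) : TopologicalSpace (WedgeOfCircles ι) :=
  inferInstanceAs (TopologicalSpace (Quot (WedgeRel ι)))

/-! ### The orthogonality graph and the frame complex -/

section Frames

variable {K : Type u} {V : Type v} [Field K] [AddCommGroup V] [Module K V]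

/-- The `2`-dimensional subspaces of `V` on which the form is non-degenerate. -/
def Hyperbolic (B : LinearMap.BilinForm K V) : Type v :=
  {S : Submodule K V // Module.finrank K S = 2 ∧ (B.restrict S).Nondegenerate}

/-- The orthogonality graph of an alternating form (which may be degenerate): the vertices are the
non-degenerate `2`-dimensional subspaces, and two of them are adjacent if they are orthogonal. -/
def orthogonalityGraph (B : LinearMap.BilinForm K V) (hB : B.IsAlt) :
    SimpleGraph (Hyperbolic B) where
  Adj S T := ∀ x ∈ S.1, ∀ y ∈ T.1, B x y = 0
  symm := ⟨fun _ _ h x hx y hy => hB.isRefl y x (h y hy x hx)⟩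
  loopless := ⟨fun S h => by
    have hbot : S.1 = ⊥ := by
      rw [Submodule.eq_bot_iff]
      intro x hx
      have := S.2.2.1 ⟨x, hx⟩ fun y => h x hx y.1 y.2
      simpa using congrArg Subtype.val this
    have h2 := S.2.1
    rw [hbot, finrank_bot] at h2
    omega⟩

/-- The frame complex: the clique complex of the orthogonality graph. -/
def frameComplex (B : LinearMap.BilinForm K V) (hB : B.IsAlt) :
    AbstractSimplicialComplex (Hyperbolic B) :=
  cliqueComplex (orthogonalityGraph B hB)

end Frames

end SymplecticFrames

end

/-! Everything rests on orthogonal complements of non-degenerate subspaces. For n = 2 the plane S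
has exactly one neighbour, its complement (`existsUnique_adj`). The graph is then a perfect
matching, its clique complex a disjoint union of segments, and the components number half the
planes. Planes are counted by double counting pairs (x, y) with B x y = 1 (`card_hyperbolic_le`);
over an infinite field there are |K| planes.

For n = 3 two orthogonal planes determine a third, the complement of their sum, so every edge lies
in exactly one triangle (`uniqueTriangles_orthogonalityGraph`). The complex is a union of triangles
sharing at most a vertex pairwise. Each triangle retracts onto the two edges at its vertex nearest a
root (`TriangleSystem.homotopyEquivSpine`), and collapsing a spanning tree of the resulting graph
leaves a rose (`nonempty_homotopyEquiv_rose`). Two edges per triangle against one tree edge per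
non-root vertex give 2 * #triangles - #vertices + 1 circles, which is minus the reduced Euler
characteristic. A vertex farthest from the root lies in two triangles, and this yields an edge
outside the tree.

Connectivity is that of the graph. In rank at least six, a non-radical vector a orthogonal to both
planes gives a path of length three (`edist_le_three`); in non-degenerate dimension at least eight,
the complement of S + T contains a common neighbour (`edist_le_two`). In rank four, with or without
a radical, the component of S is exhausted by the neighbours of S and of one neighbour T of S, and
some plane is neither (`not_connected_of_rank_four`). -/

noncomputable section

namespace SymplecticFrames

open scoped unitInterval

/-! ### The topology of the geometric realization -/

namespace Realization

variable {W : Type u} {X : AbstractSimplicialComplex W}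

/-- The point of the realization with the given barycentric coordinates, supported in a face. -/
def ofCoord (c : W →₀ ℝ) (h0 : ∀ w, 0 ≤ c w) (h1 : (c.sum fun _ a => a) = 1) {s : Finset W}
    (hs : s ∈ X.faces) (hc : c.support ⊆ s) : Realization X where
  coord := c
  nonneg := h0
  sum_eq_one := h1
  support_mem := (X.isRelLowerSet_faces hs).2 hc (by
    rw [Finset.nonempty_iff_ne_empty]
    intro h
    simp [Finsupp.support_eq_empty.mp h] at h1)

/-- The vertex of the realization belonging to a vertex of the complex. -/
def vertex (X : AbstractSimplicialComplex W) (w : W) : Realization X :=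
  ofCoord (Finsupp.single w 1) (fun v => by classical rw [Finsupp.single_apply]; split_ifs <;> simp)
    (by simp) (X.singleton_mem w) Finsupp.support_single_subset

@[simp]
theorem vertex_coord (w : W) : (vertex X w).coord = Finsupp.single w 1 := rfl

theorem support_vertex (w : W) : (vertex X w).coord.support = {w} :=
  Finsupp.support_single w (one_ne_zero)

theorem support_nonempty (x : Realization X) : x.coord.support.Nonempty :=
  (X.isRelLowerSet_faces x.support_mem).1

theorem sum_of_subset (x : Realization X) {s : Finset W} (h : x.coord.support ⊆ s) :
    ∑ w ∈ s, x.coord w = 1 := by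
  rw [← x.sum_eq_one, Finsupp.sum_of_support_subset _ h _ (by simp)]

theorem eq_vertex {x : Realization X} {w : W} (h : x.coord.support ⊆ {w}) : x = vertex X w := by
  have h1 := x.sum_of_subset h
  ext v
  by_cases hv : v = w
  · subst hv; simpa using h1
  · have : v ∉ x.coord.support := fun h' => hv (by simpa using h h')
    rw [vertex_coord, Finsupp.single_eq_of_ne hv, Finsupp.notMem_support_iff.mp this]

/-- The inclusion of a closed simplex into the realization. -/
abbrev incl (X : AbstractSimplicialComplex W) (s : Finset W) : closedSimplex X s → Realization X :=
  fun x => x.1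

theorem continuous_incl {s : Finset W} (hs : s ∈ X.faces) : Continuous (incl X s) := by
  rw [continuous_iff_coinduced_le]
  exact le_iSup (fun s : X.faces => TopologicalSpace.coinduced
    (fun x : Realization.closedSimplex X s.1 => x.1) inferInstance) ⟨s, hs⟩

/-- A map out of the realization is continuous if it is so on every closed simplex. -/
theorem continuous_of_incl {Y : Type*} [TopologicalSpace Y] {f : Realization X → Y}
    (h : ∀ s ∈ X.faces, Continuous (f ∘ incl X s)) : Continuous f := by
  rw [continuous_iff_coinduced_le]
  simp only [instTopologicalSpaceRealization]
  rw [coinduced_iSup]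
  refine iSup_le fun s => ?_
  rw [coinduced_compose, ← continuous_iff_coinduced_le]
  exact h s.1 s.2

theorem continuous_coord_incl (s : Finset W) (w : W) :
    Continuous fun x : closedSimplex X s => x.1.coord w :=
  (continuous_apply w).comp continuous_induced_dom

theorem continuous_coord (w : W) : Continuous fun x : Realization X => x.coord w :=
  continuous_of_incl fun s _ => continuous_coord_incl s w

/-- A map into a fixed closed simplex is continuous if its barycentric coordinates are. -/
theorem continuous_of_coord {Z : Type*} [TopologicalSpace Z] {f : Z → Realization X}
    {s : Finset W} (hs : s ∈ X.faces) (hf : ∀ z, (f z).coord.support ⊆ s)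
    (h : ∀ w, Continuous fun z => (f z).coord w) : Continuous f := by
  let k : Z → closedSimplex X s := fun z => ⟨f z, hf z⟩
  have : Continuous k := continuous_induced_rng.mpr (continuous_pi h)
  exact (continuous_incl hs).comp this

theorem support_mix_subset {x y : Realization X} {s : Finset W}
    (hx : x.coord.support ⊆ s) (hy : y.coord.support ⊆ s) (a b : ℝ) :
    (a • x.coord + b • y.coord).support ⊆ s := by
  classical
  exact Finsupp.support_add.trans (Finset.union_subset (Finsupp.support_smul.trans hx)
    (Finsupp.support_smul.trans hy))

/-- The point dividing the segment between two points of a common closed simplex. -/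
def mix {s : Finset W} (hs : s ∈ X.faces) (x y : Realization X)
    (hx : x.coord.support ⊆ s) (hy : y.coord.support ⊆ s) (u : I) : Realization X :=
  ofCoord ((1 - u : ℝ) • x.coord + (u : ℝ) • y.coord)
    (fun w => by
      have := x.nonneg w; have := y.nonneg w; have := u.2.1; have := u.2.2
      simp only [Finsupp.add_apply, Finsupp.smul_apply, smul_eq_mul]
      have : (0 : ℝ) ≤ 1 - u := by linarith
      positivity)
    (by
      rw [Finsupp.sum_of_support_subset _ (support_mix_subset hx hy _ _) _ (by simp)]
      simp only [Finsupp.add_apply, Finsupp.smul_apply, smul_eq_mul, Finset.sum_add_distrib,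
        ← Finset.mul_sum, sum_of_subset x hx, sum_of_subset y hy]
      ring)
    hs (support_mix_subset hx hy _ _)

theorem mix_coord {s : Finset W} (hs : s ∈ X.faces) (x y : Realization X)
    (hx : x.coord.support ⊆ s) (hy : y.coord.support ⊆ s) (u : I) (w : W) :
    (mix hs x y hx hy u).coord w = (1 - u : ℝ) * x.coord w + u * y.coord w := rfl

theorem support_mix {s : Finset W} (hs : s ∈ X.faces) (x y : Realization X)
    (hx : x.coord.support ⊆ s) (hy : y.coord.support ⊆ s) (u : I) :
    (mix hs x y hx hy u).coord.support ⊆ s :=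
  support_mix_subset hx hy _ _

theorem mix_zero {s : Finset W} (hs : s ∈ X.faces) (x y : Realization X)
    (hx : x.coord.support ⊆ s) (hy : y.coord.support ⊆ s) : mix hs x y hx hy 0 = x := by
  ext w; simp [mix_coord]

theorem mix_one {s : Finset W} (hs : s ∈ X.faces) (x y : Realization X)
    (hx : x.coord.support ⊆ s) (hy : y.coord.support ⊆ s) : mix hs x y hx hy 1 = y := by
  ext w; simp [mix_coord]

/-- The straight path between two points of a common closed simplex. -/
def segment {s : Finset W} (hs : s ∈ X.faces) (x y : Realization X)
    (hx : x.coord.support ⊆ s) (hy : y.coord.support ⊆ s) : Path x y where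
  toFun := mix hs x y hx hy
  continuous_toFun := continuous_of_coord hs (support_mix hs x y hx hy) fun w => by
    simp only [mix_coord]; fun_prop
  source' := mix_zero hs x y hx hy
  target' := mix_one hs x y hx hy

/-- Two self-maps of the realization which send every closed simplex into a common closed simplex
are homotopic, by the straight-line homotopy. -/
theorem homotopic_of_common_face (f g : C(Realization X, Realization X))
    (h : ∀ s ∈ X.faces, ∃ t ∈ X.faces, ∀ x : Realization X, x.coord.support ⊆ s →
      (f x).coord.support ⊆ t ∧ (g x).coord.support ⊆ t) : f.Homotopic g := by
  choose t ht hfg using h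
  -- The weak topology tests continuity on closed simplices only for maps out of the realization,
  -- not out of its product with `I`. The homotopy is therefore curried into a map to `C(I,
  -- Realization X)`.
  let H : Realization X → C(I, Realization X) := fun x =>
    (segment (ht _ x.support_mem) (f x) (g x) (hfg _ x.support_mem x subset_rfl).1
      (hfg _ x.support_mem x subset_rfl).2).toContinuousMap
  have hH (x : Realization X) (u : I) :
      (H x u).coord = (1 - u : ℝ) • (f x).coord + (u : ℝ) • (g x).coord := rfl
  clear_value H
  have hHc : Continuous H := by
    refine continuous_of_incl fun s hs => ?_
    refine ContinuousMap.continuous_of_continuous_uncurry _ ?_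
    refine continuous_of_coord (ht s hs) (fun z => ?_) fun w => ?_
    · simp only [Function.uncurry, Function.comp_apply, hH]
      exact support_mix_subset (hfg s hs _ z.1.2).1 (hfg s hs _ z.1.2).2 _ _
    · have hc (k : C(Realization X, Realization X)) :
          Continuous fun z : closedSimplex X s × I => (k z.1.1).coord w :=
        (continuous_coord w).comp (k.continuous.comp ((continuous_incl hs).comp continuous_fst))
      have hu : Continuous fun z : closedSimplex X s × I => (z.2 : ℝ) :=
        continuous_subtype_val.comp continuous_snd
      simp only [Function.uncurry, Function.comp_apply, hH, Finsupp.add_apply, Finsupp.smul_apply,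
        smul_eq_mul]
      exact ((continuous_const.sub hu).mul (hc f)).add (hu.mul (hc g))
  refine ⟨⟨⟨fun p => H p.2 p.1, ?_⟩, fun x => ?_, fun x => ?_⟩⟩
  · exact (ContinuousMap.continuous_uncurry_of_continuous ⟨H, hHc⟩).comp continuous_swap
  · ext w; simp [hH]
  · ext w; simp [hH]

theorem joined_vertex (x : Realization X) {w : W} (hw : w ∈ x.coord.support) :
    Joined x (vertex X w) :=
  ⟨segment x.support_mem x (vertex X w) subset_rfl (by simpa [support_vertex] using hw)⟩

/-- A map from the vertices to a discrete space which is constant on the faces extends to the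
realization. -/
def toDiscrete {D : Type*} [TopologicalSpace D] (p : W → D)
    (hp : ∀ s ∈ X.faces, ∀ v ∈ s, ∀ w ∈ s, p v = p w) : C(Realization X, D) where
  toFun x := p x.support_nonempty.choose
  continuous_toFun := continuous_of_incl fun s hs => by
    obtain ⟨v, hv⟩ := (X.isRelLowerSet_faces hs).1
    refine (continuous_const (y := p v)).congr fun x => ?_
    exact hp s hs _ hv _ (x.2 x.1.support_nonempty.choose_spec)

theorem toDiscrete_eq {D : Type*} [TopologicalSpace D] (p : W → D)
    (hp : ∀ s ∈ X.faces, ∀ v ∈ s, ∀ w ∈ s, p v = p w) (x : Realization X) {w : W}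
    (hw : w ∈ x.coord.support) : toDiscrete p hp x = p w :=
  hp _ x.support_mem _ x.support_nonempty.choose_spec _ hw

theorem toDiscrete_vertex {D : Type*} [TopologicalSpace D] (p : W → D)
    (hp : ∀ s ∈ X.faces, ∀ v ∈ s, ∀ w ∈ s, p v = p w) (w : W) :
    toDiscrete p hp (vertex X w) = p w :=
  toDiscrete_eq p hp _ (by simp)

/-- A complex which is a disjoint union of cones is homotopy equivalent to the discrete set of
its apices. -/
theorem nonempty_homotopyEquiv_discrete
    {D : Type*} [TopologicalSpace D] [DiscreteTopology D]
    (p : W → D) (c : D → W) (hc : ∀ d, p (c d) = d)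
    (hp : ∀ s ∈ X.faces, ∀ v ∈ s, ∀ w ∈ s, p v = p w)
    (hf : ∀ s ∈ X.faces, ∀ v ∈ s, ∃ t ∈ X.faces, s ⊆ t ∧ c (p v) ∈ t) :
    Nonempty (ContinuousMap.HomotopyEquiv (Realization X) D) := by
  let g : C(D, Realization X) := ⟨fun d => vertex X (c d), continuous_of_discreteTopology⟩
  refine ⟨⟨toDiscrete p hp, g, ?_, ?_⟩⟩
  · refine homotopic_of_common_face _ _ fun s hs => ?_
    obtain ⟨v, hv⟩ := (X.isRelLowerSet_faces hs).1
    obtain ⟨t, ht, hst, hct⟩ := hf s hs v hv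
    refine ⟨t, ht, fun x hx => ⟨?_, hx.trans hst⟩⟩
    obtain ⟨w, hw⟩ := x.support_nonempty
    have : toDiscrete p hp x = p v :=
      (toDiscrete_eq p hp x hw).trans (hp s hs _ (hx hw) _ hv)
    simpa [g, this, support_vertex] using hct
  · have : (toDiscrete p hp).comp g = ContinuousMap.id D := by
      ext d; simp [g, toDiscrete_vertex, hc]
    rw [this]

/-- The connected components of a disjoint union of cones correspond to the apices. -/
theorem nonempty_connectedComponents_equiv
    {D : Type*} [TopologicalSpace D] [DiscreteTopology D]
    (p : W → D) (c : D → W) (hc : ∀ d, p (c d) = d)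
    (hp : ∀ s ∈ X.faces, ∀ v ∈ s, ∀ w ∈ s, p v = p w)
    (hf : ∀ s ∈ X.faces, ∀ v ∈ s, ∃ t ∈ X.faces, s ⊆ t ∧ c (p v) ∈ t) :
    Nonempty (ConnectedComponents (Realization X) ≃ D) := by
  have hj (x : Realization X) : Joined x (vertex X (c (toDiscrete p hp x))) := by
    obtain ⟨w, hw⟩ := x.support_nonempty
    obtain ⟨t, ht, hst, hct⟩ := hf _ x.support_mem w hw
    rw [toDiscrete_eq p hp x hw]
    exact ⟨segment ht x _ hst (by simpa [support_vertex] using hct)⟩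
  refine ⟨Equiv.ofBijective (toDiscrete p hp).continuous.connectedComponentsLift ⟨?_, ?_⟩⟩
  · intro a b
    refine Quotient.inductionOn₂ a b fun x y hxy => ?_
    replace hxy : toDiscrete p hp x = toDiscrete p hp y := hxy
    have : Joined x y := (hj x).trans (hxy ▸ (hj y).symm)
    exact ConnectedComponents.coe_eq_coe'.mpr
      (pathComponent_subset_component y this.symm)
  · intro d
    exact ⟨ConnectedComponents.mk (vertex X (c d)),
      (toDiscrete_vertex p hp (c d)).trans (hc d)⟩

end Realization

open Realization in
/-- The clique complex of a graph is connected if and only if the graph is. -/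
theorem connectedSpace_realization_cliqueComplex_iff {W : Type u} (G : SimpleGraph W) :
    ConnectedSpace (Realization (cliqueComplex G)) ↔ G.Connected := by
  constructor
  · intro h
    have hne : Nonempty W := by
      obtain ⟨x⟩ := h.toNonempty
      exact ⟨x.support_nonempty.choose⟩
    -- The components of the graph, taken as a discrete space, receive a continuous map, which is
    -- constant on a connected realization.
    let _ : TopologicalSpace G.ConnectedComponent := ⊥
    have : DiscreteTopology G.ConnectedComponent := ⟨rfl⟩
    have hp : ∀ s ∈ (cliqueComplex G).faces, ∀ v ∈ s, ∀ w ∈ s,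
        G.connectedComponentMk v = G.connectedComponentMk w := by
      intro s hs v hv w hw
      by_cases hvw : v = w
      · rw [hvw]
      · exact SimpleGraph.ConnectedComponent.eq.mpr (hs.2 hv hw hvw).reachable
    refine SimpleGraph.Connected.mk fun v w => ?_
    have := PreconnectedSpace.constant (inferInstance) (toDiscrete _ hp).continuous
      (x := vertex _ v) (y := vertex _ w)
    rw [toDiscrete_vertex, toDiscrete_vertex] at this
    exact SimpleGraph.ConnectedComponent.eq.mp this
  · intro h
    obtain ⟨w₀⟩ := h.nonempty
    have hadj {v w : W} (hvw : G.Adj v w) :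
        Joined (vertex (cliqueComplex G) v) (vertex (cliqueComplex G) w) := by
      classical
      have hs : ({v, w} : Finset W) ∈ (cliqueComplex G).faces :=
        ⟨⟨v, by simp⟩, by simpa [SimpleGraph.isClique_pair] using fun _ => hvw⟩
      exact ⟨segment hs _ _ (by simp) (by simp)⟩
    have hw (w : W) : Joined (vertex (cliqueComplex G) w₀) (vertex (cliqueComplex G) w) := by
      obtain ⟨q⟩ := h.preconnected w₀ w
      induction q with
      | nil => exact Joined.refl _
      | cons hvw _ ih => exact (hadj hvw).trans ih
    have : PathConnectedSpace (Realization (cliqueComplex G)) := by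
      refine ⟨⟨vertex _ w₀⟩, fun x y => ?_⟩
      obtain ⟨v, hv⟩ := x.support_nonempty
      obtain ⟨w, hw'⟩ := y.support_nonempty
      exact (joined_vertex x hv).trans ((hw v).symm.trans ((hw w).trans (joined_vertex y hw').symm))
    infer_instance

/-! ### Topological graphs -/

/-- The gluing relation of a topological graph: the ends of an edge are identified with its
source and its target. -/
inductive GraphRel {P : Type u} {E : Type v} (src tgt : E → P) :
    (Σ _ : P, Unit) ⊕ (Σ _ : E, I) → (Σ _ : P, Unit) ⊕ (Σ _ : E, I) → Prop
  | source (e : E) : GraphRel src tgt (Sum.inr ⟨e, 0⟩) (Sum.inl ⟨src e, ()⟩)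
  | target (e : E) : GraphRel src tgt (Sum.inr ⟨e, 1⟩) (Sum.inl ⟨tgt e, ()⟩)

/-- The topological graph with vertices `P` and edges `E`. -/
def GraphSpace {P : Type u} {E : Type v} (src tgt : E → P) : Type max u v :=
  Quot (GraphRel src tgt)

namespace GraphSpace

variable {P : Type u} {E : Type v} {src tgt : E → P}

/-- The sigma types over points and over copies of `I` make vertices and edges discrete families
without putting a topology on `P` or `E`. -/
instance : TopologicalSpace (GraphSpace src tgt) :=
  inferInstanceAs (TopologicalSpace (Quot (GraphRel src tgt)))

/-- The vertices of a topological graph. -/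
def vert (src tgt : E → P) (p : P) : GraphSpace src tgt :=
  Quot.mk _ (Sum.inl ⟨p, ()⟩)

/-- The edges of a topological graph. -/
def edge (src tgt : E → P) (e : E) : Path (vert src tgt (src e)) (vert src tgt (tgt e)) where
  toFun u := Quot.mk _ (Sum.inr ⟨e, u⟩)
  continuous_toFun := continuous_quot_mk.comp (continuous_inr.comp continuous_sigmaMk)
  source' := Quot.sound (GraphRel.source e)
  target' := Quot.sound (GraphRel.target e)

variable {Y : Type*} [TopologicalSpace Y]

/-- The map out of a topological graph given by points and paths. -/
def desc (f : P → Y) (γ : ∀ e, Path (f (src e)) (f (tgt e))) : C(GraphSpace src tgt, Y) where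
  toFun := Quot.lift (Sum.elim (fun p => f p.1) fun e => γ e.1 e.2) (by
    rintro _ _ (e | e) <;> simp)
  continuous_toFun := continuous_quot_lift _ (Continuous.sumElim
    (continuous_sigma fun p => continuous_const (y := f p))
    (continuous_sigma fun e => (γ e).continuous))

theorem map_edge_desc (f : P → Y) (γ : ∀ e, Path (f (src e)) (f (tgt e))) (e : E) :
    (edge src tgt e).map (desc f γ).continuous = γ e := rfl

@[elab_as_elim]
theorem ind {motive : GraphSpace src tgt → Prop} (hv : ∀ p, motive (vert src tgt p))
    (he : ∀ e u, motive (edge src tgt e u)) (x : GraphSpace src tgt) : motive x := by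
  obtain ⟨⟨p, ⟨⟩⟩ | ⟨e, u⟩, rfl⟩ := Quot.exists_rep x
  · exact hv p
  · exact he e u

/-- A homotopy between maps out of a topological graph is given by a path for every vertex and a
square for every edge. -/
theorem homotopic_of_squares (f g : C(GraphSpace src tgt, Y))
    (γ : ∀ p, Path (f (vert src tgt p)) (g (vert src tgt p))) (H : E → C(I × I, Y))
    (h0 : ∀ e u, H e (0, u) = γ (src e) u) (h1 : ∀ e u, H e (1, u) = γ (tgt e) u)
    (hf : ∀ e u, H e (u, 0) = f (edge src tgt e u))
    (hg : ∀ e u, H e (u, 1) = g (edge src tgt e u)) : f.Homotopic g := by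
  -- A homotopy is a map to the path space, so `desc` applies once more: each square becomes a path
  -- in `C(I, Y)`.
  let F : C(GraphSpace src tgt, C(I, Y)) :=
    desc (fun p => (γ p).toContinuousMap) fun e =>
      { toContinuousMap := (H e).curry
        source' := by ext u; exact h0 e u
        target' := by ext u; exact h1 e u }
  refine ⟨⟨⟨fun p => F p.2 p.1, ?_⟩, fun x => ?_, fun x => ?_⟩⟩
  · exact (ContinuousMap.continuous_uncurry_of_continuous F).comp continuous_swap
  · induction x using ind with
    | hv p => exact (γ p).source
    | he e u => exact hf e u
  · induction x using ind with
    | hv p => exact (γ p).target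
    | he e u => exact hg e u

/-- Maps out of a topological graph which agree on the vertices and are path-homotopic on the
edges are homotopic. -/
theorem desc_homotopic_of_homotopic (f : P → Y) (γ γ' : ∀ e, Path (f (src e)) (f (tgt e)))
    (h : ∀ e, (γ e).Homotopic (γ' e)) : (desc f γ).Homotopic (desc f γ') := by
  let H (e : E) : (γ e).Homotopy (γ' e) := (h e).some
  refine homotopic_of_squares _ _ (fun p => Path.refl (f p))
    (fun e => (H e).toContinuousMap.comp ⟨Prod.swap, continuous_swap⟩) ?_ ?_ ?_ ?_
  · intro e u; exact (H e).source u
  · intro e u; exact (H e).target u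
  · intro e u; exact (H e).apply_zero u
  · intro e u; exact (H e).apply_one u

theorem eq_desc (f : C(GraphSpace src tgt, Y)) :
    f = desc (fun p => f (vert src tgt p)) fun e => (edge src tgt e).map f.continuous := by
  ext x
  induction x using ind with
  | hv p => rfl
  | he e u => rfl

/-- The bilinear reparametrization of the square which shrinks the conjugate
`(p.trans q).trans r.symm` to its middle part `q`. -/
def conjParam (z : I × I) : I :=
  -- The path `(p.trans q).trans r.symm` traverses `p` on [0, 1/4], `q` on [1/4, 1/2] and `r`
  -- backwards on [1/2, 1]. The corners (0,0), (0,1), (1,1), (1,0) go to 0, 1/4, 1/2, 1.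
  ⟨(1 - z.1 : ℝ) * (z.2 / 4) + z.1 * (1 - z.2 / 2), by
    obtain ⟨⟨x, hx0, hx1⟩, ⟨y, hy0, hy1⟩⟩ := z
    have : 0 ≤ 1 - x := by linarith
    have : 0 ≤ 1 - y / 2 := by linarith
    constructor
    · dsimp only; positivity
    · dsimp only; nlinarith⟩

theorem continuous_conjParam : Continuous conjParam :=
  Continuous.subtype_mk (by fun_prop) _

/-- This and the next three lemmas read off the sides of the square: `p` on the left, `r` on the
right, `q` on top, the whole path at the bottom. -/
theorem conj_conjParam_left {a b c d : Y} (p : Path a b) (q : Path b c) (r : Path d c) (u : I) :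
    ((p.trans q).trans r.symm) (conjParam (0, u)) = p u := by
  have := u.2.1; have := u.2.2
  have h1 : ((conjParam (0, u) : I) : ℝ) = u / 4 := by simp [conjParam]
  rw [Path.trans_apply, dif_pos (by rw [h1]; linarith), Path.trans_apply,
    dif_pos (by simp only [h1]; linarith)]
  congr 1
  ext
  simp only [h1]
  ring

theorem conj_conjParam_right {a b c d : Y} (p : Path a b) (q : Path b c) (r : Path d c) (u : I) :
    ((p.trans q).trans r.symm) (conjParam (1, u)) = r u := by
  have := u.2.1; have := u.2.2
  have h1 : ((conjParam (1, u) : I) : ℝ) = 1 - u / 2 := by simp [conjParam]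
  -- At u = 1 the parameter is the breakpoint 1/2, which `Path.trans_apply` assigns to the first
  -- half; the value is then the endpoint of `q`.
  by_cases hu : (u : ℝ) = 1
  · have hu' : u = 1 := Subtype.ext hu
    rw [Path.trans_apply, dif_pos (by rw [h1, hu]; norm_num)]
    rw [show (⟨2 * (conjParam (1, u) : ℝ), _⟩ : I) = 1 from
      Subtype.ext (by simp [h1, hu]; norm_num)]
    simp [hu']
  · have : (u : ℝ) < 1 := lt_of_le_of_ne u.2.2 hu
    rw [Path.trans_apply, dif_neg (by rw [h1]; linarith), Path.symm_apply]
    refine congrArg r (Subtype.ext ?_)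
    simp only [h1, unitInterval.coe_symm_eq]
    ring

theorem conj_conjParam_top {a b c d : Y} (p : Path a b) (q : Path b c) (r : Path d c) (u : I) :
    ((p.trans q).trans r.symm) (conjParam (u, 1)) = q u := by
  have := u.2.1; have := u.2.2
  have h1 : ((conjParam (u, 1) : I) : ℝ) = 1 / 4 + u / 4 := by simp [conjParam]; ring
  rw [Path.trans_apply, dif_pos (by rw [h1]; linarith), Path.trans_apply]
  by_cases hu : (u : ℝ) = 0
  · have hu' : u = 0 := Subtype.ext hu
    rw [dif_pos (by simp only [h1, hu]; norm_num)]
    rw [show (⟨2 * (2 * (conjParam (u, 1) : ℝ)), _⟩ : I) = 1 from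
      Subtype.ext (by simp [h1, hu]; norm_num)]
    simp [hu']
  · have : 0 < (u : ℝ) := lt_of_le_of_ne u.2.1 (Ne.symm hu)
    rw [dif_neg (by simp only [h1]; linarith)]
    congr 1
    ext
    simp only [h1]
    ring

theorem conjParam_bottom (u : I) : conjParam (u, 0) = u := by
  ext; simp [conjParam]

/-- Two maps out of a topological graph are homotopic if there are paths between the images of the
vertices which conjugate the images of the edges into each other, up to path homotopy. -/
theorem homotopic_of_conj (f g : C(GraphSpace src tgt, Y))
    (γ : ∀ p, Path (f (vert src tgt p)) (g (vert src tgt p)))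
    (h : ∀ e, ((edge src tgt e).map f.continuous).Homotopic
      (((γ (src e)).trans ((edge src tgt e).map g.continuous)).trans (γ (tgt e)).symm)) :
    f.Homotopic g := by
  rw [eq_desc f]
  -- The edges are first deformed with the vertices fixed, then the vertices slide along `γ`.
  refine (desc_homotopic_of_homotopic (fun p => f (vert src tgt p)) _ _ h).trans ?_
  refine homotopic_of_squares _ _ γ (fun e =>
    (((γ (src e)).trans ((edge src tgt e).map g.continuous)).trans
      (γ (tgt e)).symm).toContinuousMap.comp ⟨conjParam, continuous_conjParam⟩) ?_ ?_ ?_ ?_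
  · intro e u; exact conj_conjParam_left _ _ _ u
  · intro e u; exact conj_conjParam_right _ _ _ u
  · intro e u
    simp only [ContinuousMap.comp_apply, ContinuousMap.coe_mk, conjParam_bottom]
    rfl
  · intro e u; exact conj_conjParam_top _ _ _ u

/-! #### Collapsing a spanning tree -/

section Tree

variable {r : P} {rank : P → ℕ} {par : P → E} (htgt : ∀ p, p ≠ r → tgt (par p) = p)
  (hrank : ∀ p, p ≠ r → rank (src (par p)) < rank p)

/-- The path from the root to a vertex in the spanning tree given by the parent edges. -/
def treePath (htgt : ∀ p, p ≠ r → tgt (par p) = p)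
    (hrank : ∀ p, p ≠ r → rank (src (par p)) < rank p) (p : P) :
    Path (vert src tgt r) (vert src tgt p) :=
  open Classical in
  if h : p = r then (Path.refl (vert src tgt r)).cast rfl (by rw [h])
  else ((treePath htgt hrank (src (par p))).trans (edge src tgt (par p))).cast rfl (by rw [htgt p h])
termination_by rank p
decreasing_by exact hrank p h

theorem treePath_root : treePath htgt hrank r = Path.refl (vert src tgt r) := by
  rw [treePath, dif_pos rfl]
  rfl

theorem treePath_tgt (e : E) (hr : tgt e ≠ r) (he : par (tgt e) = e) :
    treePath htgt hrank (tgt e) = (treePath htgt hrank (src e)).trans (edge src tgt e) := by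
  -- With `p` and `e` independent variables, the equation `par p = e` can be substituted despite the
  -- casts in the path types.
  have key : ∀ (p : P) (hp : p ≠ r) (e : E) (_ : par p = e) (ht : tgt e = p),
      treePath htgt hrank p =
        ((treePath htgt hrank (src e)).trans (edge src tgt e)).cast rfl (by rw [ht]) := by
    rintro p hp _ rfl ht
    rw [treePath, dif_neg hp]
  exact key _ hr e he rfl

/-- The set of edges outside the spanning tree. -/
abbrev coTree (tgt : E → P) (par : P → E) : Type v := {e : E // par (tgt e) ≠ e}

/-- The wedge of circles as a topological graph with one vertex. -/
abbrev Rose (ι : Type v) : Type v :=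
  GraphSpace (fun _ : ι => PUnit.unit.{v + 1}) fun _ => PUnit.unit

/-- The map which collapses the spanning tree. -/
def collapse (src tgt : E → P) (par : P → E) : C(GraphSpace src tgt, Rose (coTree tgt par)) :=
  open Classical in
  desc (fun _ => vert _ _ PUnit.unit) fun e =>
    if h : par (tgt e) ≠ e then edge (fun _ : coTree tgt par => PUnit.unit) (fun _ => PUnit.unit)
      ⟨e, h⟩
    else Path.refl _

theorem map_collapse_of_tree {e : E} (h : par (tgt e) = e) :
    (edge src tgt e).map (collapse src tgt par).continuous = Path.refl (vert _ _ PUnit.unit) :=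
  (map_edge_desc _ _ e).trans (dif_neg (not_not.mpr h))

theorem map_collapse_of_coTree (e : coTree tgt par) :
    (edge src tgt e.1).map (collapse src tgt par).continuous = edge _ _ e :=
  (map_edge_desc _ _ e.1).trans (dif_pos e.2)

/-- The loop in a topological graph given by an edge outside the spanning tree. -/
def expand (htgt : ∀ p, p ≠ r → tgt (par p) = p)
    (hrank : ∀ p, p ≠ r → rank (src (par p)) < rank p) :
    C(Rose (coTree tgt par), GraphSpace src tgt) :=
  desc (fun _ => vert _ _ r) fun e =>
    ((treePath htgt hrank (src e.1)).trans (edge src tgt e.1)).trans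
      (treePath htgt hrank (tgt e.1)).symm

/-- A tree path consists of tree edges, each of which is collapsed to a constant path. -/
theorem collapse_treePath (p : P) :
    ((treePath htgt hrank p).map (collapse src tgt par).continuous).Homotopic
      (Path.refl (vert _ _ PUnit.unit)) := by
  induction hn : rank p using Nat.strong_induction_on generalizing p with
  | _ n ih =>
    by_cases hp : p = r
    · subst hp
      rw [treePath_root]
      exact Path.Homotopic.refl _
    · have hlt := hrank p hp
      have hpt := htgt p hp
      generalize hpe : par p = e at hlt hpt
      subst hpt
      rw [treePath_tgt htgt hrank e hp hpe, Path.map_trans]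
      have h1 := ih _ (hn ▸ hlt) (src e) rfl
      rw [map_collapse_of_tree hpe]
      exact (h1.hcomp (Path.Homotopic.refl _)).trans ⟨Path.Homotopy.reflTrans _⟩

/-- A connected topological graph is homotopy equivalent to the rose obtained by collapsing a
spanning tree. -/
theorem nonempty_homotopyEquiv_rose (hroot : ∀ e, tgt e ≠ r)
    (htgt : ∀ p, p ≠ r → tgt (par p) = p)
    (hrank : ∀ p, p ≠ r → rank (src (par p)) < rank p) :
    Nonempty (ContinuousMap.HomotopyEquiv (GraphSpace src tgt) (Rose (coTree tgt par))) := by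
  refine ⟨⟨collapse src tgt par, expand htgt hrank, ?_, ?_⟩⟩
  -- Each vertex moves from the root along its tree path. For a tree edge the conjugate is a tree
  -- path followed by its inverse; for any other edge it is the loop used in `expand`.
  · refine homotopic_of_conj _ _ (fun p => treePath htgt hrank p) fun e => ?_
    by_cases he : par (tgt e) = e
    · have h2 : (edge src tgt e).map ((expand htgt hrank).comp (collapse src tgt par)).continuous =
          Path.refl (vert src tgt r) := by
        ext u
        change expand htgt hrank ((edge src tgt e).map (collapse src tgt par).continuous u) = _
        rw [map_collapse_of_tree he]
        rfl
      rw [h2]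
      change Path.Homotopic _ (((treePath htgt hrank (src e)).trans (edge src tgt e)).trans _)
      rw [← treePath_tgt htgt hrank e (hroot e) he]
      exact ⟨Path.Homotopy.reflTransSymm _⟩
    · have h2 : (edge src tgt e).map ((expand htgt hrank).comp (collapse src tgt par)).continuous =
          ((treePath htgt hrank (src e)).trans (edge src tgt e)).trans
            (treePath htgt hrank (tgt e)).symm := by
        ext u
        change expand htgt hrank ((edge src tgt e).map (collapse src tgt par).continuous u) = _
        rw [map_collapse_of_coTree ⟨e, he⟩]
        rfl
      rw [h2]
      exact Path.Homotopic.refl _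
  · refine homotopic_of_conj _ _ (fun _ => Path.refl (vert _ _ PUnit.unit)) fun e => ?_
    have h2 : (edge (fun _ : coTree tgt par => PUnit.unit) (fun _ => PUnit.unit) e).map
        ((collapse src tgt par).comp (expand htgt hrank)).continuous =
        (((treePath htgt hrank (src e.1)).map (collapse src tgt par).continuous).trans
          ((edge src tgt e.1).map (collapse src tgt par).continuous)).trans
            ((treePath htgt hrank (tgt e.1)).map (collapse src tgt par).continuous).symm := by
      rw [Path.map_symm, ← Path.map_trans, ← Path.map_trans]
      rfl
    rw [h2, map_collapse_of_coTree]
    exact ((collapse_treePath htgt hrank _).hcomp (Path.Homotopic.refl _)).hcomp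
      (collapse_treePath htgt hrank _).symm₂

end Tree

/-! #### The rose is the wedge of circles -/

/-- The standard parametrization of the circle by the unit interval. -/
def circleParam (u : I) : Circle := Circle.exp (2 * Real.pi * u)

theorem continuous_circleParam : Continuous circleParam := by
  unfold circleParam; fun_prop

theorem circleParam_zero : circleParam 0 = 1 := by simp [circleParam]

theorem circleParam_one : circleParam 1 = 1 := by simp [circleParam, Circle.exp_two_pi]

theorem circleParam_surjective : Function.Surjective circleParam := by
  intro z
  have hpi := Real.pi_pos
  obtain ⟨x, ⟨hx1, hx2⟩, rfl⟩ := Circle.surjOn_exp_neg_pi_pi (Set.mem_univ z)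
  by_cases hx : 0 ≤ x
  · refine ⟨⟨x / (2 * Real.pi), by positivity, ?_⟩, ?_⟩
    · rw [div_le_one (by positivity)]; linarith
    · simp only [circleParam]
      congr 1
      field_simp
  · refine ⟨⟨(x + 2 * Real.pi) / (2 * Real.pi), div_nonneg (by linarith) (by positivity), ?_⟩, ?_⟩
    · rw [div_le_one (by positivity)]; linarith
    · simp only [circleParam]
      rw [← Circle.exp_add_two_pi x]
      congr 1
      field_simp

/-- The parameters differ by an integer, which lies between -1 and 1; it is nonzero only when they
are opposite endpoints. -/
theorem circleParam_eq {u w : I} (h : circleParam u = circleParam w) :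
    u = w ∨ ((u = 0 ∨ u = 1) ∧ (w = 0 ∨ w = 1)) := by
  have hpi := Real.pi_pos
  obtain ⟨m, hm⟩ := Circle.exp_eq_exp.mp h
  have hm' : (u : ℝ) = w + m := by
    have : 2 * Real.pi * (u : ℝ) = 2 * Real.pi * (w + m) := by rw [hm]; ring
    exact mul_left_cancel₀ (by positivity) this
  have hu0 := u.2.1; have hu1 := u.2.2; have hw0 := w.2.1; have hw1 := w.2.2
  have h1 : (m : ℝ) ≤ 1 := by linarith
  have h2 : (-1 : ℝ) ≤ m := by linarith
  have h1' : m ≤ 1 := by exact_mod_cast h1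
  have h2' : -1 ≤ m := by exact_mod_cast h2
  have : m = -1 ∨ m = 0 ∨ m = 1 := by omega
  rcases this with rfl | rfl | rfl
  · push_cast at hm'
    exact Or.inr ⟨Or.inl (Subtype.ext (by push_cast; linarith)),
      Or.inr (Subtype.ext (by push_cast; linarith))⟩
  · left; ext; simpa using hm'
  · push_cast at hm'
    exact Or.inr ⟨Or.inr (Subtype.ext (by push_cast; linarith)),
      Or.inl (Subtype.ext (by push_cast; linarith))⟩

/-- A continuous surjection from a compact space to a Hausdorff space is closed. -/
theorem isQuotientMap_circleParam : Topology.IsQuotientMap circleParam :=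
  (continuous_circleParam.isClosedMap).isQuotientMap continuous_circleParam circleParam_surjective

theorem edge_factorsThrough {ι : Type v} (i : ι) :
    Function.FactorsThrough (edge (fun _ : ι => PUnit.unit.{v + 1}) (fun _ => PUnit.unit) i)
      circleParam := fun u w h => by
  have h0 := (edge (fun _ : ι => PUnit.unit.{v + 1}) (fun _ => PUnit.unit) i).source
  have h1 := (edge (fun _ : ι => PUnit.unit.{v + 1}) (fun _ => PUnit.unit) i).target
  rcases circleParam_eq h with rfl | ⟨rfl | rfl, rfl | rfl⟩
  · rfl
  · rfl
  · exact h0.trans h1.symm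
  · exact h1.trans h0.symm
  · rfl

/-- The circles of a rose. -/
def petal {ι : Type v} (i : ι) : C(Circle, Rose ι) :=
  Topology.IsQuotientMap.lift (f := ⟨circleParam, continuous_circleParam⟩)
    isQuotientMap_circleParam (edge _ _ i).toContinuousMap (edge_factorsThrough i)

theorem petal_circleParam {ι : Type v} (i : ι) (u : I) :
    petal i (circleParam u) = edge _ _ i u :=
  DFunLike.congr_fun (Topology.IsQuotientMap.lift_comp (f := ⟨circleParam, continuous_circleParam⟩)
    isQuotientMap_circleParam (edge _ _ i).toContinuousMap (edge_factorsThrough i)) u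

/-- The map from the rose to the wedge of circles. -/
def roseToWedge (ι : Type v) : C(Rose ι, WedgeOfCircles ι) :=
  desc (fun _ => Quot.mk _ (Sum.inl ())) fun i =>
    { toFun := fun u => Quot.mk _ (Sum.inr ⟨i, circleParam u⟩)
      continuous_toFun := continuous_quot_mk.comp (continuous_inr.comp
        (continuous_sigmaMk.comp continuous_circleParam))
      source' := by
        rw [circleParam_zero]
        exact (Quot.sound (WedgeRel.glue i)).symm
      target' := by
        rw [circleParam_one]
        exact (Quot.sound (WedgeRel.glue i)).symm }

/-- The map from the wedge of circles to the rose. -/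
def wedgeToRose (ι : Type v) : C(WedgeOfCircles ι, Rose ι) where
  toFun := Quot.lift (Sum.elim (fun _ => vert _ _ PUnit.unit) fun z => petal z.1 z.2) (by
    rintro _ _ ⟨i⟩
    simp only [Sum.elim_inl, Sum.elim_inr]
    rw [← circleParam_zero, petal_circleParam, Path.source])
  continuous_toFun := continuous_quot_lift _ (Continuous.sumElim continuous_const
    (continuous_sigma fun i => (petal i).continuous))

/-- The rose is homeomorphic to the wedge of circles. -/
def roseHomeomorph (ι : Type v) : Rose ι ≃ₜ WedgeOfCircles ι where
  toFun := roseToWedge ι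
  invFun := wedgeToRose ι
  left_inv x := by
    induction x using ind with
    | hv p => rfl
    | he e u => exact petal_circleParam e u
  right_inv x := by
    obtain ⟨⟨⟩ | ⟨i, z⟩, rfl⟩ := Quot.exists_rep x
    · rfl
    · obtain ⟨u, rfl⟩ := circleParam_surjective z
      exact congrArg (roseToWedge ι) (petal_circleParam i u)
  continuous_toFun := (roseToWedge ι).continuous
  continuous_invFun := (wedgeToRose ι).continuous

end GraphSpace

/-! ### Complexes glued from triangles along vertices. -/

open Classical in
/-- The set with the three given elements. -/
abbrev triple {W : Type u} (a b c : W) : Finset W := {a, b, c}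

/-- A complex which is a union of triangles, any two of which share at most one vertex. Every
triangle has a distinguished vertex, its apex. -/
structure TriangleSystem {W : Type u} (X : AbstractSimplicialComplex W) (T : Type u) where
  /-- The distinguished vertex of a triangle. -/
  apex : T → W
  /-- The second vertex of a triangle. -/
  left : T → W
  /-- The third vertex of a triangle. -/
  right : T → W
  apex_ne_left : ∀ t, apex t ≠ left t
  apex_ne_right : ∀ t, apex t ≠ right t
  left_ne_right : ∀ t, left t ≠ right t
  mem_faces : ∀ t, triple (apex t) (left t) (right t) ∈ X.faces
  exists_subset : ∀ s ∈ X.faces, ∃ t, s ⊆ triple (apex t) (left t) (right t)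
  unique : ∀ t t' v w, v ≠ w → v ∈ triple (apex t) (left t) (right t) →
    w ∈ triple (apex t) (left t) (right t) → v ∈ triple (apex t') (left t') (right t') →
    w ∈ triple (apex t') (left t') (right t') → t = t'

namespace TriangleSystem

open Realization GraphSpace

variable {W : Type u} {X : AbstractSimplicialComplex W} {T : Type u} (S : TriangleSystem X T)

/-- The vertices of a triangle. -/
def verts (t : T) : Finset W := triple (S.apex t) (S.left t) (S.right t)

/-- The source of the two edges at the apex. -/
def src (e : T × Bool) : W := S.apex e.1

/-- The target of the two edges at the apex. -/
def tgt (e : T × Bool) : W := if e.2 then S.left e.1 else S.right e.1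

theorem src_mem (e : T × Bool) : S.src e ∈ S.verts e.1 := by simp [src, verts]

theorem tgt_mem (e : T × Bool) : S.tgt e ∈ S.verts e.1 := by
  unfold tgt verts; split_ifs <;> simp

/-- The space formed by the two edges at the apex of every triangle. -/
abbrev Spine : Type u := GraphSpace S.src S.tgt

/-- The path running from the right vertex through the apex to the left vertex, parametrized by
the interval from `-1` to `1`. -/
def fold (t : T) (z : ℝ) : S.Spine :=
  if 0 ≤ z then (edge S.src S.tgt (t, true)).extend z else (edge S.src S.tgt (t, false)).extend (-z)

theorem continuous_fold (t : T) : Continuous (S.fold t) := by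
  refine Continuous.if_le (Path.continuous_extend _)
    ((Path.continuous_extend _).comp continuous_neg) continuous_const continuous_id ?_
  rintro z rfl
  simp only [neg_zero, Path.extend_zero]
  rfl

theorem fold_zero (t : T) : S.fold t 0 = vert S.src S.tgt (S.apex t) := by
  rw [fold, if_pos le_rfl, Path.extend_zero]
  rfl

theorem fold_coe (t : T) (u : I) : S.fold t u = edge S.src S.tgt (t, true) u := by
  rw [fold, if_pos u.2.1, Path.extend_apply _ u.2]

theorem fold_neg_coe (t : T) (u : I) : S.fold t (-u) = edge S.src S.tgt (t, false) u := by
  by_cases hu : (u : ℝ) = 0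
  · have hu' : u = 0 := Subtype.ext hu
    rw [hu, neg_zero, fold_zero, hu', Path.source]
    rfl
  · have : 0 < (u : ℝ) := lt_of_le_of_ne u.2.1 (Ne.symm hu)
    rw [fold, if_neg (by linarith), neg_neg, Path.extend_apply _ u.2]

/-- The left coordinate minus the right one is 0, 1, -1 at the apex, the left and the right vertex.
-/
theorem fold_vertex {t : T} {v : W} (hv : v ∈ S.verts t) :
    S.fold t ((vertex X v).coord (S.left t) - (vertex X v).coord (S.right t)) =
      vert S.src S.tgt v := by
  classical
  have h1 := S.apex_ne_left t
  have h2 := S.apex_ne_right t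
  have h3 := S.left_ne_right t
  simp only [verts, triple, Finset.mem_insert, Finset.mem_singleton] at hv
  simp only [vertex_coord, Finsupp.single_apply]
  rcases hv with rfl | rfl | rfl
  · rw [if_neg h1, if_neg h2, sub_zero, fold_zero]
  · rw [if_pos rfl, if_neg h3, sub_zero]
    exact (S.fold_coe t 1).trans (Path.target _)
  · rw [if_pos rfl, if_neg h3.symm, zero_sub]
    exact (S.fold_neg_coe t 1).trans (Path.target _)

/-- The triangle containing a given point. -/
def triangleOf (x : Realization X) : T := (S.exists_subset _ x.support_mem).choose

theorem support_subset_triangleOf (x : Realization X) :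
    x.coord.support ⊆ S.verts (S.triangleOf x) :=
  (S.exists_subset _ x.support_mem).choose_spec

/-- The retraction onto the spine, as a function. -/
def retractFun (x : Realization X) : S.Spine :=
  S.fold (S.triangleOf x) (x.coord (S.left (S.triangleOf x)) - x.coord (S.right (S.triangleOf x)))

/-- The chosen triangle does not matter: two points of the support determine it, and a support of
one point is a vertex, which every triangle through it sends to the same place. -/
theorem retractFun_eq {x : Realization X} {t : T} (h : x.coord.support ⊆ S.verts t) :
    S.retractFun x = S.fold t (x.coord (S.left t) - x.coord (S.right t)) := by
  have h' := S.support_subset_triangleOf x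
  by_cases hx : ∃ v ∈ x.coord.support, ∃ w ∈ x.coord.support, v ≠ w
  · obtain ⟨v, hv, w, hw, hvw⟩ := hx
    rw [retractFun, S.unique _ t v w hvw (h' hv) (h' hw) (h hv) (h hw)]
  · push Not at hx
    obtain ⟨v, hv⟩ := x.support_nonempty
    obtain rfl := eq_vertex (x := x) (w := v) fun w hw => by simpa using hx w hw v hv
    rw [retractFun, S.fold_vertex (h' hv), S.fold_vertex (h hv)]

/-- The retraction onto the spine. -/
def retract : C(Realization X, S.Spine) where
  toFun := S.retractFun
  continuous_toFun := continuous_of_incl fun s hs => by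
    obtain ⟨t, ht⟩ := S.exists_subset s hs
    refine ((S.continuous_fold t).comp ((continuous_coord_incl s (S.left t)).sub
      (continuous_coord_incl s (S.right t)))).congr fun x => ?_
    exact (S.retractFun_eq (x.2.trans ht)).symm

theorem support_vertex_src (e : T × Bool) : (vertex X (S.src e)).coord.support ⊆ S.verts e.1 := by
  rw [support_vertex, Finset.singleton_subset_iff]; exact S.src_mem e

theorem support_vertex_tgt (e : T × Bool) : (vertex X (S.tgt e)).coord.support ⊆ S.verts e.1 := by
  rw [support_vertex, Finset.singleton_subset_iff]; exact S.tgt_mem e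

/-- The inclusion of the spine. -/
def embed : C(S.Spine, Realization X) :=
  desc (vertex X) fun e => segment (S.mem_faces e.1) (vertex X (S.src e)) (vertex X (S.tgt e))
    (S.support_vertex_src e) (S.support_vertex_tgt e)

theorem support_embed_edge (e : T × Bool) (u : I) :
    (S.embed (edge S.src S.tgt e u)).coord.support ⊆ S.verts e.1 :=
  support_mix (S.mem_faces e.1) (vertex X (S.src e)) (vertex X (S.tgt e))
    (S.support_vertex_src e) (S.support_vertex_tgt e) u

theorem embed_edge_coord (e : T × Bool) (u : I) (w : W) :
    (S.embed (edge S.src S.tgt e u)).coord w =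
      (1 - u : ℝ) * Finsupp.single (S.src e) 1 w + u * Finsupp.single (S.tgt e) 1 w := rfl

theorem support_embed_fold (t : T) (z : ℝ) : (S.embed (S.fold t z)).coord.support ⊆ S.verts t := by
  rw [fold]
  split_ifs
  · exact S.support_embed_edge (t, true) _
  · exact S.support_embed_edge (t, false) _

theorem retract_embed (x : S.Spine) : S.retract (S.embed x) = x := by
  classical
  induction x using GraphSpace.ind with
  | hv p =>
    obtain ⟨t, ht⟩ := S.exists_subset _ (X.singleton_mem p)
    have hp : p ∈ S.verts t := ht (by simp)
    exact (S.retractFun_eq (x := vertex X p) (t := t)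
      (by rw [support_vertex]; exact ht)).trans (S.fold_vertex hp)
  | he e u =>
    obtain ⟨t, b⟩ := e
    have h1 := S.apex_ne_left t
    have h2 := S.apex_ne_right t
    have h3 := S.left_ne_right t
    refine (S.retractFun_eq (S.support_embed_edge (t, b) u)).trans ?_
    rw [embed_edge_coord, embed_edge_coord]
    cases b
    · simpa [src, tgt, Finsupp.single_apply, h1, h2, h3, h3.symm] using S.fold_neg_coe t u
    · simpa [src, tgt, Finsupp.single_apply, h1, h2, h3, h3.symm] using S.fold_coe t u

/-- A union of triangles which meet in at most one vertex is homotopy equivalent to its spine. -/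
def homotopyEquivSpine : ContinuousMap.HomotopyEquiv (Realization X) S.Spine where
  toFun := S.retract
  invFun := S.embed
  left_inv := by
    -- Retracting keeps every point inside its own triangle, so the straight-line homotopy is
    -- available.
    refine homotopic_of_common_face _ _ fun s hs => ?_
    obtain ⟨t, ht⟩ := S.exists_subset s hs
    refine ⟨_, S.mem_faces t, fun x hx => ⟨?_, hx.trans ht⟩⟩
    have : S.retract x = _ := S.retractFun_eq (hx.trans ht)
    rw [ContinuousMap.comp_apply, this]
    exact S.support_embed_fold t _
  right_inv := by
    rw [show S.retract.comp S.embed = ContinuousMap.id _ from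
      ContinuousMap.ext fun x => S.retract_embed x]

end TriangleSystem

/-! ### Graphs in which every edge lies in exactly one triangle -/

section UniqueTriangles

variable {W : Type u} {G : SimpleGraph W}

/-- The triangles of a graph. -/
abbrev Tri (G : SimpleGraph W) : Type u := {t : Finset W // G.IsNClique 3 t}

/-- Every edge of the graph lies in exactly one triangle. -/
def UniqueTriangles (G : SimpleGraph W) : Prop :=
  ∀ a b, G.Adj a b → ∃! c, G.Adj a c ∧ G.Adj b c

theorem isNClique_triple {a b c : W} (hab : G.Adj a b) (hac : G.Adj a c) (hbc : G.Adj b c) :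
    G.IsNClique 3 (triple a b c) := by
  classical
  exact SimpleGraph.is3Clique_iff.mpr ⟨a, b, c, hab, hac, hbc, by unfold triple; congr⟩

theorem UniqueTriangles.eq_of_mem (hG : UniqueTriangles G) {t t' : Tri G} {v w : W} (hvw : v ≠ w)
    (hv : v ∈ t.1) (hw : w ∈ t.1) (hv' : v ∈ t'.1) (hw' : w ∈ t'.1) : t = t' := by
  classical
  have key (t : Tri G) (hv : v ∈ t.1) (hw : w ∈ t.1) :
      ∃ c, (G.Adj v c ∧ G.Adj w c) ∧ t.1 = {v, w, c} := by
    have hcard : ((t.1.erase v).erase w).card = 1 := by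
      rw [Finset.card_erase_of_mem (by simp [hw, hvw.symm]), Finset.card_erase_of_mem hv, t.2.2]
    obtain ⟨c, hc⟩ := Finset.card_eq_one.mp hcard
    have hcm : c ∈ (t.1.erase v).erase w := by rw [hc]; simp
    simp only [Finset.mem_erase] at hcm
    refine ⟨c, ⟨t.2.1 hv hcm.2.2 (Ne.symm hcm.2.1), t.2.1 hw hcm.2.2 (Ne.symm hcm.1)⟩, ?_⟩
    rw [← hc, Finset.insert_erase (by simp [hw, hvw.symm]), Finset.insert_erase hv]
  obtain ⟨c, hc, ht⟩ := key t hv hw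
  obtain ⟨c', hc', ht'⟩ := key t' hv' hw'
  have := (hG v w (t.2.1 hv hw hvw)).unique hc hc'
  exact Subtype.ext (by rw [ht, ht', this])

theorem UniqueTriangles.exists_tri_of_adj (hG : UniqueTriangles G) {v w : W} (h : G.Adj v w) :
    ∃ t : Tri G, v ∈ t.1 ∧ w ∈ t.1 := by
  obtain ⟨c, ⟨hc1, hc2⟩, -⟩ := hG v w h
  exact ⟨⟨_, isNClique_triple h hc1 hc2⟩, by simp [triple], by simp [triple]⟩

/-- An edge vw of the clique has only one common neighbour, so any further element of the clique is
the third vertex of its triangle. The hypothesis `hd` serves the one-point cliques. -/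
theorem UniqueTriangles.exists_tri (hG : UniqueTriangles G) (hd : ∀ v, ∃ w, G.Adj v w)
    {s : Finset W} (hs : s.Nonempty) (hc : G.IsClique (s : Set W)) : ∃ t : Tri G, s ⊆ t.1 := by
  obtain ⟨v, hv⟩ := hs
  by_cases h : ∃ w ∈ s, w ≠ v
  · obtain ⟨w, hw, hwv⟩ := h
    obtain ⟨t, htv, htw⟩ := hG.exists_tri_of_adj (hc hv hw hwv.symm)
    refine ⟨t, fun x hx => ?_⟩
    by_cases hxv : x = v
    · rwa [hxv]
    by_cases hxw : x = w
    · rwa [hxw]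
    have hvx := hc hv hx (Ne.symm hxv)
    have hwx := hc hw hx (Ne.symm hxw)
    have hvw := hc hv hw hwv.symm
    have : t = ⟨_, isNClique_triple hvw hvx hwx⟩ :=
      hG.eq_of_mem hwv.symm htv htw (by simp [triple]) (by simp [triple])
    rw [this]
    simp [triple]
  · push Not at h
    obtain ⟨w, hw⟩ := hd v
    obtain ⟨t, htv, -⟩ := hG.exists_tri_of_adj hw
    exact ⟨t, fun x hx => h x hx ▸ htv⟩

/-- For `f` the distance to the root, `o` becomes the apex, so no spine edge leads closer to the
root. -/
theorem exists_ordered_triple (f : W → ℕ) (t : Tri G) :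
    ∃ o a b : W, o ≠ a ∧ o ≠ b ∧ a ≠ b ∧ t.1 = triple o a b ∧ f o ≤ f a ∧ f o ≤ f b := by
  classical
  have hne : t.1.Nonempty := Finset.card_pos.mp (by rw [t.2.2]; norm_num)
  obtain ⟨o, ho, hmin⟩ := Finset.exists_min_image t.1 f hne
  have hcard : (t.1.erase o).card = 2 := by rw [Finset.card_erase_of_mem ho, t.2.2]
  obtain ⟨a, b, hab, h⟩ := Finset.card_eq_two.mp hcard
  have ha : a ∈ t.1.erase o := by rw [h]; simp
  have hb : b ∈ t.1.erase o := by rw [h]; simp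
  simp only [Finset.mem_erase] at ha hb
  refine ⟨o, a, b, Ne.symm ha.1, Ne.symm hb.1, hab, ?_, hmin a ha.2, hmin b hb.2⟩
  rw [← Finset.insert_erase ho, h]

theorem exists_adj_dist_lt (hc : G.Connected) {r p : W} (hp : p ≠ r) :
    ∃ w, G.Adj p w ∧ G.dist w r < G.dist p r := by
  obtain ⟨q, hq⟩ := hc.exists_walk_length_eq_dist p r
  cases q with
  | nil => exact absurd rfl hp
  | @cons _ w _ h q =>
    refine ⟨w, h, ?_⟩
    have := SimpleGraph.dist_le q
    rw [SimpleGraph.Walk.length_cons] at hq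
    omega

/-- The target map is a bijection from tree edges to non-root vertices. -/
theorem card_coTree {P : Type u} {E : Type v} [Finite P] [Finite E] {tgt : E → P} {par : P → E}
    {r : P} (hroot : ∀ e, tgt e ≠ r) (htgt : ∀ p, p ≠ r → tgt (par p) = p) :
    Nat.card (GraphSpace.coTree tgt par) + Nat.card P = Nat.card E + 1 := by
  classical
  have := Fintype.ofFinite P
  have := Fintype.ofFinite E
  have e1 : {e : E // par (tgt e) = e} ≃ {p : P // p ≠ r} :=
    { toFun := fun e => ⟨tgt e.1, hroot e.1⟩
      invFun := fun p => ⟨par p.1, by rw [htgt p.1 p.2]⟩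
      left_inv := fun e => Subtype.ext e.2
      right_inv := fun p => Subtype.ext (htgt p.1 p.2) }
  have h1 := Nat.card_congr e1
  have h2 := Nat.card_congr (Equiv.sumCompl fun e : E => par (tgt e) = e)
  have h3 := Nat.card_congr (Equiv.sumCompl fun p : P => p = r)
  rw [Nat.card_sum] at h2 h3
  have h4 : Nat.card {p : P // p = r} = 1 := by simp
  have h5 : Nat.card (GraphSpace.coTree tgt par) = Nat.card {e : E // ¬ par (tgt e) = e} := rfl
  have h6 : Nat.card {p : P // p ≠ r} = Nat.card {p : P // ¬ p = r} := rfl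
  omega

/-- The clique complex of a connected graph in which every edge lies in exactly one triangle is
homotopy equivalent to a wedge of circles. -/
theorem UniqueTriangles.exists_wedge (hG : UniqueTriangles G) (hd : ∀ v, ∃ w, G.Adj v w)
    (hc : G.Connected) :
    ∃ ι : Type u,
      Nonempty (ContinuousMap.HomotopyEquiv (Realization (cliqueComplex G)) (WedgeOfCircles ι)) ∧
      (Finite W → Nat.card ι + Nat.card W = 2 * Nat.card (Tri G) + 1) ∧
      ((∃ d, ∀ v w, G.dist v w ≤ d) →
        (∀ v, ∃ t t' : Tri G, t ≠ t' ∧ v ∈ t.1 ∧ v ∈ t'.1) → Nonempty ι) := by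
  classical
  obtain ⟨r⟩ := hc.nonempty
  choose o a b hoa hob hab htri hmina hminb using
    exists_ordered_triple (G := G) fun p => G.dist p r
  let S : TriangleSystem (cliqueComplex G) (Tri G) :=
    { apex := o
      left := a
      right := b
      apex_ne_left := hoa
      apex_ne_right := hob
      left_ne_right := hab
      mem_faces := fun t => ⟨by simp [triple], htri t ▸ t.2.1⟩
      exists_subset := fun s hs => by
        obtain ⟨t, ht⟩ := hG.exists_tri hd hs.1 hs.2
        exact ⟨t, htri t ▸ ht⟩
      unique := fun t t' v w hvw h1 h2 h3 h4 => by
        rw [← htri] at h1 h2 h3 h4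
        exact hG.eq_of_mem hvw h1 h2 h3 h4 }
  have hverts (t : Tri G) : S.verts t = t.1 := (htri t).symm
  have hmin (t : Tri G) (v : W) (hv : v ∈ t.1) : G.dist (o t) r ≤ G.dist v r := by
    rw [htri t] at hv
    simp only [triple, Finset.mem_insert, Finset.mem_singleton] at hv
    rcases hv with rfl | rfl | rfl
    exacts [le_rfl, hmina t, hminb t]
  have hsrc_ne (e : Tri G × Bool) : S.src e ≠ S.tgt e := by
    obtain ⟨t, _ | _⟩ := e
    exacts [hob t, hoa t]
  have hexists (t : Tri G) (v : W) (hv : v ∈ t.1) (hvo : v ≠ o t) :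
      ∃ b, S.tgt (t, b) = v := by
    rw [htri t] at hv
    simp only [triple, Finset.mem_insert, Finset.mem_singleton] at hv
    rcases hv with h | h | h
    · exact absurd h hvo
    · exact ⟨true, h.symm⟩
    · exact ⟨false, h.symm⟩
  -- If an edge ended at the root, its apex would also have distance zero and coincide with its
  -- target.
  have hroot (e : Tri G × Bool) : S.tgt e ≠ r := by
    intro he
    have h1 := hmin e.1 _ (hverts e.1 ▸ S.tgt_mem e)
    rw [he, SimpleGraph.dist_self, Nat.le_zero, hc.dist_eq_zero_iff] at h1
    exact hsrc_ne e (h1.trans he.symm)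
  -- A neighbour of p closer to the root spans a triangle with p whose apex is at least as close.
  -- Hence p is not the apex, and the edge from apex to p can be the parent edge.
  have hpar (p : W) : ∃ e : Tri G × Bool,
      p ≠ r → S.tgt e = p ∧ G.dist (S.src e) r < G.dist p r := by
    by_cases hp : p = r
    · obtain ⟨w, hw⟩ := hd p
      obtain ⟨t, -, -⟩ := hG.exists_tri_of_adj hw
      exact ⟨(t, true), fun h => absurd hp h⟩
    · obtain ⟨w, hw, hlt⟩ := exists_adj_dist_lt hc hp
      obtain ⟨t, hpt, hwt⟩ := hG.exists_tri_of_adj hw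
      have hlt' : G.dist (o t) r < G.dist p r := (hmin t w hwt).trans_lt hlt
      obtain ⟨b, hb⟩ := hexists t p hpt (by rintro h; rw [← h] at hlt'; exact lt_irrefl _ hlt')
      exact ⟨(t, b), fun _ => ⟨hb, hlt'⟩⟩
  choose par hpar using hpar
  have htgt (p : W) (hp : p ≠ r) : S.tgt (par p) = p := (hpar p hp).1
  have hrank (p : W) (hp : p ≠ r) : G.dist (S.src (par p)) r < G.dist p r := (hpar p hp).2
  refine ⟨GraphSpace.coTree S.tgt par, ?_, ?_, ?_⟩
  · obtain ⟨h⟩ := GraphSpace.nonempty_homotopyEquiv_rose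
      (rank := fun p => G.dist p r) hroot htgt hrank
    exact ⟨(S.homotopyEquivSpine.trans h).trans
      (GraphSpace.roseHomeomorph (GraphSpace.coTree S.tgt par)).toHomotopyEquiv⟩
  · intro _
    have : Finite (Finset W) := inferInstance
    have := card_coTree hroot htgt
    rw [Nat.card_prod] at this
    simp only [Nat.card_eq_fintype_card (α := Bool), Fintype.card_bool] at this
    omega
  · rintro ⟨d, hdist⟩ htwo
    -- A vertex farthest from the root exists because distances are bounded, even in an infinite
    -- graph.
    obtain ⟨v, hv⟩ : ∃ v, ∀ w, G.dist w r ≤ G.dist v r := by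
      have hbdd : BddAbove (Set.range fun v => G.dist v r) := ⟨d, by
        rintro _ ⟨v, rfl⟩; exact hdist v r⟩
      obtain ⟨v, hv⟩ := Nat.sSup_mem (Set.range_nonempty_iff_nonempty.mpr ⟨r⟩) hbdd
      exact ⟨v, fun w => (le_csSup hbdd ⟨w, rfl⟩).trans hv.ge⟩
    obtain ⟨t, ht, hvt⟩ : ∃ t : Tri G, t ≠ (par v).1 ∧ v ∈ t.1 := by
      obtain ⟨t, t', htt, h, h'⟩ := htwo v
      by_cases h1 : t = (par v).1
      · exact ⟨t', fun h2 => htt (h1.trans h2.symm), h'⟩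
      · exact ⟨t, h1, h⟩
    -- If v is the apex of t, a tree edge leaving it would reach a farther vertex. Otherwise the
    -- edge of t ending at v is not the parent edge of v, which lies in another triangle.
    by_cases hvo : v = o t
    · refine ⟨⟨(t, true), fun h => ?_⟩⟩
      have h1 := hrank _ (hroot (t, true))
      rw [h] at h1
      have h2 : G.dist (S.src (t, true)) r = G.dist v r := by rw [hvo]; rfl
      have := hv (S.tgt (t, true))
      omega
    · obtain ⟨b, hb⟩ := hexists t v hvt hvo
      refine ⟨⟨(t, b), fun h => ht ?_⟩⟩
      rw [hb] at h
      rw [h]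

open Classical in
/-- The contribution of the faces of a triangle to the Euler characteristic which are not
vertices. -/
theorem sum_faces_of_triangle {t : Finset W} (ht : t.card = 3) :
    ∑ s ∈ t.powerset with 2 ≤ s.card, (-1 : ℤ) ^ (s.card + 1) = -2 := by
  rw [Finset.sum_filter,
    Finset.sum_powerset_apply_card (fun m => if 2 ≤ m then (-1 : ℤ) ^ (m + 1) else 0), ht]
  decide

/-- Faces with at least two vertices are sorted by the unique triangle containing them; each
triangle contributes -3 for its edges and 1 for itself. -/
theorem UniqueTriangles.reducedEulerChar_eq [Finite W] (hG : UniqueTriangles G)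
    (hd : ∀ v, ∃ w, G.Adj v w) :
    reducedEulerChar (cliqueComplex G) = -1 + Nat.card W - 2 * Nat.card (Tri G) := by
  classical
  have := Fintype.ofFinite W
  have := Fintype.ofFinite (Tri G)
  let A : Finset (Finset W) := Finset.univ.image fun w : W => ({w} : Finset W)
  let C : Finset (Finset W) := (Finset.univ : Finset (Tri G)).biUnion fun t =>
    t.1.powerset.filter fun s => 2 ≤ s.card
  have hmemC (s : Finset W) : s ∈ C ↔ ∃ t : Tri G, s ⊆ t.1 ∧ 2 ≤ s.card := by simp [C]
  have hAC : Disjoint A C := by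
    rw [Finset.disjoint_left]
    intro s hs hs'
    obtain ⟨w, -, rfl⟩ := Finset.mem_image.mp hs
    obtain ⟨t, -, h⟩ := (hmemC _).mp hs'
    simp at h
  have hfaces : (cliqueComplex G).faces = ((A ∪ C : Finset (Finset W)) : Set (Finset W)) := by
    ext s
    simp only [Finset.coe_union, Set.mem_union, Finset.mem_coe, hmemC]
    constructor
    · intro hs
      obtain ⟨t, ht⟩ := hG.exists_tri hd hs.1 hs.2
      by_cases h : 2 ≤ s.card
      · exact Or.inr ⟨t, ht, h⟩
      · have h1 : s.card = 1 := by have := hs.1.card_pos; omega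
        obtain ⟨w, rfl⟩ := Finset.card_eq_one.mp h1
        exact Or.inl (by simp [A])
    · rintro (h | ⟨t, ht, h⟩)
      · obtain ⟨w, -, rfl⟩ := Finset.mem_image.mp h
        exact (cliqueComplex G).singleton_mem w
      · exact ⟨Finset.card_pos.mp (by omega), t.2.1.subset (by exact_mod_cast ht)⟩
  have hdisj : ((Finset.univ : Finset (Tri G)) : Set (Tri G)).PairwiseDisjoint fun t =>
      t.1.powerset.filter fun s => 2 ≤ s.card := by
    intro t _ t' _ htt
    rw [Function.onFun, Finset.disjoint_left]
    intro s hs hs'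
    simp only [Finset.mem_filter, Finset.mem_powerset] at hs hs'
    obtain ⟨v, hv, w, hw, hvw⟩ := Finset.one_lt_card.mp (show 1 < s.card by omega)
    exact htt (hG.eq_of_mem hvw (hs.1 hv) (hs.1 hw) (hs'.1 hv) (hs'.1 hw))
  rw [reducedEulerChar, hfaces, finsum_mem_coe_finset, Finset.sum_union hAC,
    Finset.sum_image (fun _ _ _ _ h => Finset.singleton_injective h), Finset.sum_biUnion hdisj,
    Finset.sum_congr rfl fun t _ => sum_faces_of_triangle t.2.2]
  simp only [Finset.card_singleton, Finset.sum_const, Finset.card_univ, Nat.card_eq_fintype_card]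
  simp
  ring

/-- Both sides count ordered adjacent pairs; each triangle contains six. -/
theorem UniqueTriangles.card_tri [Finite W] (hG : UniqueTriangles G) {d : ℕ}
    (hdeg : ∀ v, Nat.card {w // G.Adj v w} = d) : Nat.card W * d = 6 * Nat.card (Tri G) := by
  classical
  have := Fintype.ofFinite W
  have := Fintype.ofFinite (Tri G)
  have h1 : (Finset.univ.filter fun p : W × W => G.Adj p.1 p.2) =
      (Finset.univ : Finset (Tri G)).biUnion fun t => t.1.offDiag := by
    ext ⟨v, w⟩
    simp only [Finset.mem_filter, Finset.mem_univ, true_and, Finset.mem_biUnion,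
      Finset.mem_offDiag]
    constructor
    · intro h
      obtain ⟨t, hv, hw⟩ := hG.exists_tri_of_adj h
      exact ⟨t, hv, hw, h.ne⟩
    · rintro ⟨t, hv, hw, hvw⟩
      exact t.2.1 hv hw hvw
  have h2 : (Finset.univ.filter fun p : W × W => G.Adj p.1 p.2).card = Nat.card (Tri G) * 6 := by
    rw [h1, Finset.card_biUnion, Finset.sum_congr rfl fun t _ => t.1.offDiag_card]
    · simp [fun t : Tri G => t.2.2]
    · intro t _ t' _ htt
      rw [Function.onFun, Finset.disjoint_left]
      rintro ⟨v, w⟩ hs hs'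
      simp only [Finset.mem_offDiag] at hs hs'
      exact htt (hG.eq_of_mem hs.2.2 hs.1 hs.2.1 hs'.1 hs'.2.1)
  have h3 : Nat.card {p : W × W // G.Adj p.1 p.2} = Nat.card W * d := by
    have e : {p : W × W // G.Adj p.1 p.2} ≃ Σ v : W, {w // G.Adj v w} :=
      { toFun := fun p => ⟨p.1.1, p.1.2, p.2⟩
        invFun := fun p => ⟨(p.1, p.2.1), p.2.2⟩
        left_inv := fun _ => rfl
        right_inv := fun _ => rfl }
    rw [Nat.card_congr e, Nat.card_sigma]
    rw [Finset.sum_congr rfl fun v _ => hdeg v]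
    simp
  rw [← h3, Nat.card_eq_fintype_card, Fintype.card_subtype, h2, mul_comm]

end UniqueTriangles

/-! ### Hyperbolic planes -/

section LinearAlgebra

open Module Submodule

variable {K : Type u} {V : Type v} [Field K] [AddCommGroup V] [Module K V]
  {B : LinearMap.BilinForm K V}

theorem apply_eq_zero_of_mem_span_pair {e f z : V} (he : B e z = 0) (hf : B f z = 0) {x : V}
    (hx : x ∈ span K {e, f}) : B x z = 0 := by
  obtain ⟨a, b, rfl⟩ := mem_span_pair.mp hx
  simp [he, hf]

theorem restrict_nondegenerate_of_left (hB : B.IsAlt) {S : Submodule K V}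
    (h : ∀ x ∈ S, (∀ y ∈ S, B x y = 0) → x = 0) : (B.restrict S).Nondegenerate := by
  have hr : (B.restrict S).IsRefl := fun x y hxy => hB.isRefl _ _ hxy
  refine hr.nondegenerate_iff_separatingLeft.mpr fun x hx => ?_
  exact Subtype.ext (h x.1 x.2 fun y hy => hx ⟨y, hy⟩)

theorem eq_zero_of_restrict_nondegenerate {S : Submodule K V} (h : (B.restrict S).Nondegenerate)
    {x : V} (hx : x ∈ S) (h0 : ∀ y ∈ S, B x y = 0) : x = 0 :=
  congrArg Subtype.val (h.1 ⟨x, hx⟩ fun y => h0 y.1 y.2)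

theorem finrank_span_pair_of_apply_ne_zero (hB : B.IsAlt) {x y : V} (h : B x y ≠ 0) :
    finrank K (span K {x, y}) = 2 := by
  have hli : LinearIndependent K ![x, y] := by
    rw [LinearIndependent.pair_iff]
    intro a b hab
    have h1 : B (a • x + b • y) y = 0 := by rw [hab]; simp
    have h2 : B x (a • x + b • y) = 0 := by rw [hab]; simp
    simp only [map_add, map_smul, LinearMap.add_apply, LinearMap.smul_apply, hB.self_eq_zero,
      smul_eq_mul, mul_zero, add_zero, zero_add, mul_eq_zero, h, or_false] at h1 h2
    exact ⟨h1, h2⟩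
  have := finrank_span_eq_card hli
  rwa [Matrix.range_cons_cons_empty, Fintype.card_fin] at this

theorem nondegenerate_span_pair (hB : B.IsAlt) {x y : V} (h : B x y ≠ 0) :
    (B.restrict (span K {x, y})).Nondegenerate := by
  refine restrict_nondegenerate_of_left hB fun z hz h0 => ?_
  obtain ⟨a, b, rfl⟩ := mem_span_pair.mp hz
  have h1 := h0 y (subset_span (by simp))
  have h2 := hB.isRefl _ _ (h0 x (subset_span (by simp)))
  simp only [map_add, map_smul, LinearMap.add_apply, LinearMap.smul_apply, hB.self_eq_zero,
    smul_eq_mul, mul_zero, add_zero, zero_add, mul_eq_zero, h, or_false] at h1 h2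
  simp [h1, h2]

/-- The hyperbolic plane spanned by two non-orthogonal vectors. -/
def plane (hB : B.IsAlt) {x y : V} (h : B x y ≠ 0) : Hyperbolic B :=
  ⟨span K {x, y}, finrank_span_pair_of_apply_ne_zero hB h, nondegenerate_span_pair hB h⟩

theorem left_mem_plane (hB : B.IsAlt) {x y : V} (h : B x y ≠ 0) : x ∈ (plane hB h).1 :=
  subset_span (by simp)

theorem right_mem_plane (hB : B.IsAlt) {x y : V} (h : B x y ≠ 0) : y ∈ (plane hB h).1 :=
  subset_span (by simp)

theorem Hyperbolic.ext {S T : Hyperbolic B} (h : S.1 = T.1) : S = T := Subtype.ext h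

theorem Hyperbolic.finiteDimensional (S : Hyperbolic B) : FiniteDimensional K S.1 :=
  FiniteDimensional.of_finrank_pos (by rw [S.2.1]; norm_num)

theorem Hyperbolic.eq_plane (S : Hyperbolic B) (hB : B.IsAlt) {x y : V} (hx : x ∈ S.1)
    (hy : y ∈ S.1) (h : B x y ≠ 0) : S = plane hB h := by
  have := S.finiteDimensional
  refine Hyperbolic.ext (Submodule.eq_of_le_of_finrank_eq ?_ ?_).symm
  · exact span_le.mpr (by rintro z (rfl | rfl) <;> assumption)
  · rw [S.2.1, (plane hB h).2.1]

theorem Hyperbolic.eq_of_le {S T : Hyperbolic B} (h : S.1 ≤ T.1) : S = T := by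
  have := T.finiteDimensional
  exact Hyperbolic.ext (Submodule.eq_of_le_of_finrank_eq h (by rw [S.2.1, T.2.1]))

theorem Hyperbolic.exists_pair (S : Hyperbolic B) :
    ∃ x ∈ S.1, ∃ y ∈ S.1, B x y = 1 := by
  have hne : S.1 ≠ ⊥ := fun h => by
    have := S.2.1
    rw [h, finrank_bot] at this
    omega
  obtain ⟨x, hx, hx0⟩ := Submodule.exists_mem_ne_zero_of_ne_bot hne
  by_contra! hcon
  refine hx0 (eq_zero_of_restrict_nondegenerate S.2.2 hx fun y hy => ?_)
  by_contra hxy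
  exact hcon x hx ((B x y)⁻¹ • y) (S.1.smul_mem _ hy) (by simp [hxy])

theorem Hyperbolic.exists_eq_plane (S : Hyperbolic B) (hB : B.IsAlt) :
    ∃ (x y : V) (h : B x y = 1), S = plane hB (h ▸ one_ne_zero : B x y ≠ 0) := by
  obtain ⟨x, hx, y, hy, h⟩ := S.exists_pair
  exact ⟨x, y, h, S.eq_plane hB hx hy _⟩

theorem adj_plane_iff (hB : B.IsAlt) {x y : V} (h : B x y ≠ 0) (T : Hyperbolic B) :
    (orthogonalityGraph B hB).Adj (plane hB h) T ↔ ∀ z ∈ T.1, B x z = 0 ∧ B y z = 0 :=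
  ⟨fun hT z hz => ⟨hT x (left_mem_plane hB h) z hz, hT y (right_mem_plane hB h) z hz⟩,
    fun hT _ hv z hz => apply_eq_zero_of_mem_span_pair (hT z hz).1 (hT z hz).2 hv⟩

theorem adj_plane_plane (hB : B.IsAlt) {x y z w : V} (h : B x y ≠ 0) (h' : B z w ≠ 0)
    (hxz : B x z = 0) (hxw : B x w = 0) (hyz : B y z = 0) (hyw : B y w = 0) :
    (orthogonalityGraph B hB).Adj (plane hB h) (plane hB h') := by
  refine (adj_plane_iff hB h _).mpr fun v hv => ?_
  obtain ⟨a, b, rfl⟩ := mem_span_pair.mp hv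
  simp [hxz, hxw, hyz, hyw]

/-- The orthogonal projection along the hyperbolic plane spanned by `e` and `f`. -/
theorem exists_perp_pair (hB : B.IsAlt) {e f : V} (hef : B e f = 1) (v : V) :
    ∃ w, B e w = 0 ∧ B f w = 0 ∧ ∀ x, B x e = 0 → B x f = 0 → B x w = B x v := by
  refine ⟨v - B e v • f + B f v • e, ?_, ?_, fun x hxe hxf => ?_⟩
  · simp [hef, hB.self_eq_zero]
  · simp [← hB.neg_eq e f, hef, hB.self_eq_zero]
  · simp [hxe, hxf]

theorem exists_apply_ne_zero {v : V} (hv : v ∉ LinearMap.ker B) : ∃ y, B v y ≠ 0 := by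
  by_contra! h
  exact hv (LinearMap.mem_ker.mpr (LinearMap.ext h))

theorem restrict_sup_nondegenerate (hB : B.IsAlt) {S T : Submodule K V}
    (hS : (B.restrict S).Nondegenerate) (hT : (B.restrict T).Nondegenerate)
    (h : ∀ x ∈ S, ∀ y ∈ T, B x y = 0) : (B.restrict (S ⊔ T)).Nondegenerate := by
  refine restrict_nondegenerate_of_left hB fun x hx h0 => ?_
  obtain ⟨s, hs, t, ht, rfl⟩ := mem_sup.mp hx
  have h1 : s = 0 := eq_zero_of_restrict_nondegenerate hS hs fun y hy => by
    have := h0 y (mem_sup_left hy)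
    rwa [map_add, LinearMap.add_apply, hB.isRefl _ _ (h y hy t ht), add_zero] at this
  have h2 : t = 0 := eq_zero_of_restrict_nondegenerate hT ht fun y hy => by
    have := h0 y (mem_sup_right hy)
    rwa [map_add, LinearMap.add_apply, h s hs y hy, zero_add] at this
  rw [h1, h2, add_zero]

theorem adj_iff_le_orthogonal {hB : B.IsAlt} {S T : Hyperbolic B} :
    (orthogonalityGraph B hB).Adj S T ↔ T.1 ≤ B.orthogonal S.1 :=
  ⟨fun h _ hy x hx => h x hx _ hy, fun h x hx _ hy => h hy x hx⟩

/-- Pairing with d vanishes on the span of a and c but not at a + b. -/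
theorem plane_add_ne (hB : B.IsAlt) {a b c d : V} (hac : B a c ≠ 0) (hbd : B b d ≠ 0)
    (had : B a d = 0) (hcd : B c d = 0) (hac' : B (a + b) c ≠ 0) :
    plane hB hac ≠ plane hB hac' := by
  intro h
  have h1 : a + b ∈ (plane hB hac).1 := h ▸ left_mem_plane hB hac'
  have h2 := apply_eq_zero_of_mem_span_pair had hcd h1
  rw [map_add, LinearMap.add_apply, had, zero_add] at h2
  exact hbd h2

theorem not_adj_plane_add (hB : B.IsAlt) {a b c : V} (hac : B a c ≠ 0)
    (hac' : B (a + b) c ≠ 0) :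
    ¬ (orthogonalityGraph B hB).Adj (plane hB hac) (plane hB hac') :=
  fun h => hac (h a (left_mem_plane hB hac) c (right_mem_plane hB hac'))

/-! ### Orthogonal pairs and the distance bound in rank at least six. -/

section FiniteDimensional

variable [FiniteDimensional K V]

/-- The k conditions cut out a subspace of codimension at most k, too large to fit into the radical.
-/
theorem exists_notMem_ker {k : ℕ} (x : Fin k → V)
    (h : finrank K (LinearMap.ker B) + k < finrank K V) :
    ∃ v, v ∉ LinearMap.ker B ∧ ∀ i, B v (x i) = 0 := by
  let φ : V →ₗ[K] (Fin k → K) := LinearMap.pi fun i => B.flip (x i)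
  by_contra! hcon
  have hle : LinearMap.ker φ ≤ LinearMap.ker B := by
    intro v hv
    by_contra hvB
    obtain ⟨i, hi⟩ := hcon v hvB
    exact hi (congrFun (LinearMap.mem_ker.mp hv) i)
  have h1 := Submodule.finrank_mono hle
  have h2 := φ.finrank_range_add_finrank_ker
  have h3 := (LinearMap.range φ).finrank_le
  rw [finrank_fin_fun] at h3
  omega

/-- There is a hyperbolic pair orthogonal to a given one. -/
theorem exists_pair_perp (hB : B.IsAlt) (hV : finrank K (LinearMap.ker B) + 2 < finrank K V)
    {e f : V} (hef : B e f = 1) :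
    ∃ g h, B g h = 1 ∧ B e g = 0 ∧ B e h = 0 ∧ B f g = 0 ∧ B f h = 0 := by
  obtain ⟨g, hg, hgef⟩ := exists_notMem_ker ![e, f] hV
  have hge : B g e = 0 := hgef 0
  have hgf : B g f = 0 := hgef 1
  obtain ⟨y, hy⟩ := exists_apply_ne_zero hg
  obtain ⟨h, heh, hfh, hh⟩ := exists_perp_pair hB hef y
  rw [← hh g hge hgf] at hy
  exact ⟨g, (B g h)⁻¹ • h, by simp [hy], hB.isRefl _ _ hge, by simp [heh], hB.isRefl _ _ hgf,
    by simp [hfh]⟩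

/-- There is a hyperbolic pair orthogonal to two given orthogonal ones. -/
theorem exists_pair_perp_perp (hB : B.IsAlt) (hV : finrank K (LinearMap.ker B) + 4 < finrank K V)
    {e f a c : V} (hef : B e f = 1) (hac : B a c = 1) (hea : B e a = 0) (hec : B e c = 0)
    (hfa : B f a = 0) (hfc : B f c = 0) :
    ∃ b d, B b d = 1 ∧ B e b = 0 ∧ B e d = 0 ∧ B f b = 0 ∧ B f d = 0 ∧
      B a b = 0 ∧ B a d = 0 ∧ B c b = 0 ∧ B c d = 0 := by
  obtain ⟨b, hb, hperp⟩ := exists_notMem_ker ![e, f, a, c] hV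
  have hbe : B b e = 0 := hperp 0
  have hbf : B b f = 0 := hperp 1
  have hba : B b a = 0 := hperp 2
  have hbc : B b c = 0 := hperp 3
  obtain ⟨y, hy⟩ := exists_apply_ne_zero hb
  obtain ⟨z, hez, hfz, hz⟩ := exists_perp_pair hB hef y
  obtain ⟨d, had, hcd, hd⟩ := exists_perp_pair hB hac z
  rw [← hz b hbe hbf, ← hd b hba hbc] at hy
  have hed : B e d = 0 := by rw [hd e hea hec, hez]
  have hfd : B f d = 0 := by rw [hd f hfa hfc, hfz]
  exact ⟨b, (B b d)⁻¹ • d, by simp [hy], hB.isRefl _ _ hbe, by simp [hed], hB.isRefl _ _ hbf,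
    by simp [hfd], hB.isRefl _ _ hba, by simp [had], hB.isRefl _ _ hbc, by simp [hcd]⟩

theorem exists_hyperbolic (hV : finrank K (LinearMap.ker B) < finrank K V) :
    ∃ e f : V, B e f = 1 := by
  obtain ⟨e, he, -⟩ := exists_notMem_ker (B := B) ![] hV
  obtain ⟨y, hy⟩ := exists_apply_ne_zero he
  exact ⟨e, (B e y)⁻¹ • y, by simp [hy]⟩

/-- Any two hyperbolic planes have distance at most three if the form has rank at least six. -/
theorem edist_le_three (hB : B.IsAlt) (hV : finrank K (LinearMap.ker B) + 4 < finrank K V)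
    (S T : Hyperbolic B) : (orthogonalityGraph B hB).edist S T ≤ 3 := by
  obtain ⟨e, f, hef, rfl⟩ := S.exists_eq_plane hB
  obtain ⟨e', f', hef', rfl⟩ := T.exists_eq_plane hB
  obtain ⟨a, ha, hperp⟩ := exists_notMem_ker ![e, f, e', f'] hV
  have hae : B a e = 0 := hperp 0
  have haf : B a f = 0 := hperp 1
  have hae' : B a e' = 0 := hperp 2
  have haf' : B a f' = 0 := hperp 3
  obtain ⟨y₀, hy₀⟩ := exists_apply_ne_zero ha
  obtain ⟨c, hec, hfc, hc⟩ := exists_perp_pair hB hef y₀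
  have hac : B a c ≠ 0 := by rwa [hc a hae haf]
  obtain ⟨d, hed', hfd', hd⟩ := exists_perp_pair hB hef' ((B a y₀)⁻¹ • y₀)
  have had : B a d = 1 := by rw [hd a hae' haf']; simp [hy₀]
  obtain ⟨x, y, hxy, hex, hey, hfx, hfy, hax, hay, -, -⟩ := exists_pair_perp_perp hB hV hef' had
    (hB.isRefl _ _ hae') hed' (hB.isRefl _ _ haf') hfd'
  -- Subtracting multiples of a makes x and y orthogonal to c. As a is orthogonal to e', f', x, y
  -- and itself, no other relation changes.
  let x' := x - (B c x / B c a) • a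
  let y' := y - (B c y / B c a) • a
  have hca : B c a ≠ 0 := fun h => hac (hB.isRefl _ _ h)
  have hxy' : B x' y' = 1 := by
    simp [x', y', hxy, hay, hB.isRefl _ _ hax, hB.self_eq_zero]
  have hea' := hB.isRefl _ _ hae'
  have hfa' := hB.isRefl _ _ haf'
  have h1 : (orthogonalityGraph B hB).Adj (plane hB (hef ▸ one_ne_zero : B e f ≠ 0))
      (plane hB hac) :=
    adj_plane_plane hB _ _ (hB.isRefl _ _ hae) hec (hB.isRefl _ _ haf) hfc
  have h2 : (orthogonalityGraph B hB).Adj (plane hB hac)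
      (plane hB (hxy' ▸ one_ne_zero : B x' y' ≠ 0)) := by
    refine adj_plane_plane hB _ _ ?_ ?_ ?_ ?_
    · simp [x', hax, hB.self_eq_zero]
    · simp [y', hay, hB.self_eq_zero]
    · simp [x', hca]
    · simp [y', hca]
  have h3 : (orthogonalityGraph B hB).Adj (plane hB (hef' ▸ one_ne_zero : B e' f' ≠ 0))
      (plane hB (hxy' ▸ one_ne_zero : B x' y' ≠ 0)) := by
    refine adj_plane_plane hB _ _ ?_ ?_ ?_ ?_
    · simp [x', hex, hea']
    · simp [y', hey, hea']
    · simp [x', hfx, hfa']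
    · simp [y', hfy, hfa']
  exact SimpleGraph.edist_le (.cons h1 (.cons h2 (.cons h3.symm .nil)))

theorem ediam_le_three (hB : B.IsAlt) (hV : finrank K (LinearMap.ker B) + 4 < finrank K V) :
    (orthogonalityGraph B hB).ediam ≤ 3 :=
  SimpleGraph.ediam_le_of_edist_le (edist_le_three hB hV)

theorem connected_orthogonalityGraph (hB : B.IsAlt)
    (hV : finrank K (LinearMap.ker B) + 4 < finrank K V) : (orthogonalityGraph B hB).Connected := by
  obtain ⟨e, f, hef⟩ := exists_hyperbolic (B := B) (show finrank K (LinearMap.ker B) < _ by omega)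
  have : Nonempty (Hyperbolic B) := ⟨plane hB (hef ▸ one_ne_zero : B e f ≠ 0)⟩
  refine SimpleGraph.connected_of_ediam_ne_top fun h => ?_
  have := ediam_le_three hB hV
  rw [h] at this
  exact absurd this (by decide)

/-! ### Orthogonal sums -/

theorem Hyperbolic.finrank_sup {hB : B.IsAlt} {S T : Hyperbolic B}
    (h : (orthogonalityGraph B hB).Adj S T) : finrank K ↥(S.1 ⊔ T.1) = 4 := by
  have hdisj : S.1 ⊓ T.1 = ⊥ := by
    rw [eq_bot_iff]
    rintro x ⟨hxS, hxT⟩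
    exact eq_zero_of_restrict_nondegenerate S.2.2 hxS fun y hy => hB.isRefl _ _ (h y hy x hxT)
  have := Submodule.finrank_sup_add_finrank_inf_eq S.1 T.1
  rw [hdisj, finrank_bot, S.2.1, T.2.1] at this
  omega

theorem finrank_add_finrank_orthogonal_of_nondegenerate (hB : B.IsAlt) {W : Submodule K V}
    (hW : (B.restrict W).Nondegenerate) :
    finrank K W + finrank K (B.orthogonal W) = finrank K V :=
  Submodule.finrank_add_eq_of_isCompl
    (LinearMap.BilinForm.isCompl_orthogonal_of_restrict_nondegenerate hB.isRefl hW)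

theorem restrict_orthogonal_nondegenerate (hB : B.IsAlt) (hBn : B.Nondegenerate)
    {W : Submodule K V} (hW : (B.restrict W).Nondegenerate) :
    (B.restrict (B.orthogonal W)).Nondegenerate := by
  rw [LinearMap.BilinForm.restrict_nondegenerate_iff_isCompl_orthogonal hB.isRefl,
    LinearMap.BilinForm.orthogonal_orthogonal hBn hB.isRefl]
  exact (LinearMap.BilinForm.isCompl_orthogonal_of_restrict_nondegenerate hB.isRefl hW).symm

/-- The radical is contained in every orthogonal complement, and here the dimensions agree. -/
theorem orthogonal_eq_ker (hB : B.IsAlt) {W : Submodule K V} (hW : (B.restrict W).Nondegenerate)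
    (h : finrank K W + finrank K (LinearMap.ker B) = finrank K V) :
    B.orthogonal W = LinearMap.ker B := by
  refine (Submodule.eq_of_le_of_finrank_eq (fun x hx => ?_) ?_).symm
  · intro y _
    exact hB.isRefl _ _ (by rw [LinearMap.mem_ker.mp hx]; rfl)
  · have := finrank_add_finrank_orthogonal_of_nondegenerate hB hW
    omega

/-- In a non-degenerate space, a non-degenerate subspace of codimension two has exactly one
hyperbolic plane orthogonal to it. -/
theorem existsUnique_le_orthogonal (hB : B.IsAlt) (hBn : B.Nondegenerate) {W : Submodule K V}
    (hW : (B.restrict W).Nondegenerate) (hfr : finrank K W + 2 = finrank K V) :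
    ∃! T : Hyperbolic B, T.1 ≤ B.orthogonal W := by
  have h2 : finrank K (B.orthogonal W) = 2 := by
    have := finrank_add_finrank_orthogonal_of_nondegenerate hB hW
    omega
  refine ⟨⟨B.orthogonal W, h2, restrict_orthogonal_nondegenerate hB hBn hW⟩, le_rfl, fun T hT => ?_⟩
  exact Hyperbolic.eq_of_le hT

theorem existsUnique_adj (hB : B.IsAlt) (hBn : B.Nondegenerate) (hV : finrank K V = 4)
    (S : Hyperbolic B) : ∃! T, (orthogonalityGraph B hB).Adj S T := by
  simp only [adj_iff_le_orthogonal]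
  exact existsUnique_le_orthogonal hB hBn S.2.2 (by rw [S.2.1, hV])

/-- The common neighbours of S and T are the planes in the complement of S + T, which is itself a
hyperbolic plane. -/
theorem uniqueTriangles_orthogonalityGraph (hB : B.IsAlt) (hBn : B.Nondegenerate)
    (hV : finrank K V = 6) : UniqueTriangles (orthogonalityGraph B hB) := by
  intro S T h
  have h1 := existsUnique_le_orthogonal hB hBn (restrict_sup_nondegenerate hB S.2.2 T.2.2 h)
    (by rw [Hyperbolic.finrank_sup h, hV])
  have h2 (R : Hyperbolic B) : R.1 ≤ B.orthogonal (S.1 ⊔ T.1) ↔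
      (orthogonalityGraph B hB).Adj S R ∧ (orthogonalityGraph B hB).Adj T R := by
    rw [adj_iff_le_orthogonal, adj_iff_le_orthogonal]
    constructor
    · exact fun hR => ⟨hR.trans (LinearMap.BilinForm.orthogonal_le le_sup_left),
        hR.trans (LinearMap.BilinForm.orthogonal_le le_sup_right)⟩
    · rintro ⟨hS, hT⟩ x hx y hy
      obtain ⟨s, hs, t, ht, rfl⟩ := mem_sup.mp hy
      change B (s + t) x = 0
      rw [map_add, LinearMap.add_apply, hS hx s hs, hT hx t ht, add_zero]
  simpa only [h2] using h1

/-! ### Distances in the orthogonality graph -/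

/-- Every hyperbolic plane has two different neighbours which are not adjacent if the form has
rank at least six. -/
theorem exists_two_neighbors (hB : B.IsAlt) (hV : finrank K (LinearMap.ker B) + 4 < finrank K V)
    (S : Hyperbolic B) : ∃ T T', (orthogonalityGraph B hB).Adj S T ∧
      (orthogonalityGraph B hB).Adj S T' ∧ T ≠ T' ∧ ¬ (orthogonalityGraph B hB).Adj T T' := by
  obtain ⟨e, f, hef, rfl⟩ := S.exists_eq_plane hB
  obtain ⟨a, c, hac, hea, hec, hfa, hfc⟩ := exists_pair_perp hB (by omega) hef
  obtain ⟨b, d, hbd, heb, hed, hfb, hfd, hab, had, hcb, hcd⟩ :=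
    exists_pair_perp_perp hB hV hef hac hea hec hfa hfc
  have hac0 : B a c ≠ 0 := hac ▸ one_ne_zero
  have hac' : B (a + b) c ≠ 0 := by simp [hac, hB.isRefl _ _ hcb]
  exact ⟨plane hB hac0, plane hB hac', adj_plane_plane hB _ _ hea hec hfa hfc,
    adj_plane_plane hB _ _ (by simp [hea, heb]) hec (by simp [hfa, hfb]) hfc,
    plane_add_ne hB hac0 (hbd ▸ one_ne_zero : B b d ≠ 0) had hcd hac',
    not_adj_plane_add hB hac0 hac'⟩

/-- Any non-orthogonal pair in Z, the complement of S + T, spans a common neighbour. Were Z totally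
isotropic, it would lie in S + T and, having dimension at least 4, equal it; but S contains a
non-orthogonal pair. -/
theorem edist_le_two (hB : B.IsAlt) (hBn : B.Nondegenerate) (hV : 8 ≤ finrank K V)
    (S T : Hyperbolic B) : (orthogonalityGraph B hB).edist S T ≤ 2 := by
  set Z := B.orthogonal (S.1 ⊔ T.1) with hZ
  have hfin : finrank K ↥(S.1 ⊔ T.1) ≤ 4 := by
    have := Submodule.finrank_add_le_finrank_add_finrank S.1 T.1
    rwa [S.2.1, T.2.1] at this
  have hZfin : finrank K Z = finrank K V - finrank K ↥(S.1 ⊔ T.1) :=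
    LinearMap.BilinForm.finrank_orthogonal hBn _
  obtain ⟨x, hx, y, hy, hxy⟩ : ∃ x ∈ Z, ∃ y ∈ Z, B x y ≠ 0 := by
    by_contra! hcon
    have hle : Z ≤ S.1 ⊔ T.1 := by
      rw [← LinearMap.BilinForm.orthogonal_orthogonal hBn hB.isRefl (S.1 ⊔ T.1)]
      exact fun y hy x hx => hcon x hx y hy
    have heq : Z = S.1 ⊔ T.1 := Submodule.eq_of_le_of_finrank_le hle (by omega)
    obtain ⟨e, he, f, hf, hef⟩ := S.exists_pair
    have heZ : e ∈ Z := heq ▸ mem_sup_left he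
    have hfZ : f ∈ Z := heq ▸ mem_sup_left hf
    rw [hcon e heZ f hfZ] at hef
    exact zero_ne_one hef
  have h1 (R : Hyperbolic B) (hR : R.1 ≤ S.1 ⊔ T.1) :
      (orthogonalityGraph B hB).Adj R (plane hB hxy) := by
    intro r hr z hz
    obtain ⟨a, b, rfl⟩ := mem_span_pair.mp hz
    have hrx : B r x = 0 := hx r (hR hr)
    have hry : B r y = 0 := hy r (hR hr)
    simp [hrx, hry]
  exact SimpleGraph.edist_le (.cons (h1 S le_sup_left) (.cons (h1 T le_sup_right).symm .nil))

theorem ediam_eq_two (hB : B.IsAlt) (hBn : B.Nondegenerate) (hV : 8 ≤ finrank K V) :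
    (orthogonalityGraph B hB).ediam = 2 := by
  have hker : finrank K (LinearMap.ker B) = 0 := by rw [hBn.ker_eq_bot, finrank_bot]
  refine le_antisymm (SimpleGraph.ediam_le_of_edist_le (edist_le_two hB hBn hV)) ?_
  obtain ⟨e, f, hef⟩ := exists_hyperbolic (B := B) (show finrank K (LinearMap.ker B) < _ by omega)
  obtain ⟨T, T', hT, hT', hne, hadj⟩ :=
    exists_two_neighbors hB (by omega) (plane hB (hef ▸ one_ne_zero : B e f ≠ 0))
  rw [← SimpleGraph.edist_eq_two_iff.mpr ⟨hne, hadj, _, hT.symm, hT'.symm⟩]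
  exact SimpleGraph.edist_le_ediam

/-- The planes ⟨e, f⟩ and ⟨e + a, f + b⟩ with a, b orthogonal have distance three: for a common
neighbour R, both a and b would lie in the non-degenerate plane orthogonal to ⟨e, f⟩ + R and span
it, although B a b = 0. -/
theorem ediam_eq_three (hB : B.IsAlt) (hBn : B.Nondegenerate) (hV : finrank K V = 6) :
    (orthogonalityGraph B hB).ediam = 3 := by
  have hker : finrank K (LinearMap.ker B) = 0 := by rw [hBn.ker_eq_bot, finrank_bot]
  refine le_antisymm (ediam_le_three hB (by omega)) ?_
  obtain ⟨e, f, hef⟩ := exists_hyperbolic (B := B) (show finrank K (LinearMap.ker B) < _ by omega)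
  obtain ⟨a, c, hac, hea, hec, hfa, hfc⟩ := exists_pair_perp hB (by omega) hef
  obtain ⟨b, d, hbd, heb, hed, hfb, hfd, hab, had, hcb, hcd⟩ :=
    exists_pair_perp_perp hB (by omega) hef hac hea hec hfa hfc
  have hef0 : B e f ≠ 0 := hef ▸ one_ne_zero
  have hef' : B (e + a) (f + b) ≠ 0 := by simp [hef, heb, hB.isRefl _ _ hfa, hab]
  have hnadj : ¬ (orthogonalityGraph B hB).Adj (plane hB hef0) (plane hB hef') := fun h => by
    have := h e (left_mem_plane hB hef0) _ (right_mem_plane hB hef')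
    rw [map_add, hef, heb, add_zero] at this
    exact one_ne_zero this
  have hne : plane hB hef0 ≠ plane hB hef' := fun h => by
    have h1 : e + a ∈ (plane hB hef0).1 := h ▸ left_mem_plane hB hef'
    have h2 := apply_eq_zero_of_mem_span_pair hec hfc h1
    rw [map_add, LinearMap.add_apply, hec, hac, zero_add] at h2
    exact one_ne_zero h2
  have hcommon : (orthogonalityGraph B hB).commonNeighbors (plane hB hef0) (plane hB hef') = ∅ := by
    rw [Set.eq_empty_iff_forall_notMem]
    rintro R ⟨hR, hR'⟩
    replace hR : (orthogonalityGraph B hB).Adj (plane hB hef0) R := hR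
    replace hR' : (orthogonalityGraph B hB).Adj (plane hB hef') R := hR'
    rw [adj_plane_iff] at hR'
    have hR0 := (adj_plane_iff hB hef0 R).mp hR
    have hW := restrict_sup_nondegenerate hB (plane hB hef0).2.2 R.2.2 hR
    have hmem {v : V} (hev : B e v = 0) (hfv : B f v = 0) (hRv : ∀ x ∈ R.1, B x v = 0) :
        v ∈ B.orthogonal ((plane hB hef0).1 ⊔ R.1) := by
      intro y hy
      obtain ⟨s, hs, t, ht, rfl⟩ := mem_sup.mp hy
      change B (s + t) v = 0
      rw [map_add, LinearMap.add_apply, apply_eq_zero_of_mem_span_pair hev hfv hs, hRv t ht,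
        add_zero]
    have ha : a ∈ B.orthogonal ((plane hB hef0).1 ⊔ R.1) := hmem hea hfa fun x hx => by
      have h1 := (hR' x hx).1
      rw [map_add, LinearMap.add_apply, (hR0 x hx).1, zero_add] at h1
      exact hB.isRefl _ _ h1
    have hb : b ∈ B.orthogonal ((plane hB hef0).1 ⊔ R.1) := hmem heb hfb fun x hx => by
      have h1 := (hR' x hx).2
      rw [map_add, LinearMap.add_apply, (hR0 x hx).2, zero_add] at h1
      exact hB.isRefl _ _ h1
    have hnd := restrict_orthogonal_nondegenerate hB hBn hW
    have hfr : finrank K (B.orthogonal ((plane hB hef0).1 ⊔ R.1)) = 2 := by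
      have := finrank_add_finrank_orthogonal_of_nondegenerate hB hW
      rw [Hyperbolic.finrank_sup hR] at this
      omega
    have hli : LinearIndependent K ![a, b] := by
      rw [LinearIndependent.pair_iff]
      intro s t hst
      have h1 : B (s • a + t • b) c = 0 := by rw [hst]; simp
      have h2 : B (s • a + t • b) d = 0 := by rw [hst]; simp
      simp only [map_add, map_smul, LinearMap.add_apply, LinearMap.smul_apply, hac, had, hbd,
        hB.isRefl _ _ hcb, smul_eq_mul, mul_zero, add_zero, zero_add, mul_one] at h1 h2
      exact ⟨h1, h2⟩
    have hspan : span K {a, b} = B.orthogonal ((plane hB hef0).1 ⊔ R.1) := by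
      refine Submodule.eq_of_le_of_finrank_eq
        (span_le.mpr (by rintro z (rfl | rfl) <;> assumption)) ?_
      have := finrank_span_eq_card hli
      rw [Matrix.range_cons_cons_empty, Fintype.card_fin] at this
      rw [this, hfr]
    have ha0 : a = 0 := eq_zero_of_restrict_nondegenerate hnd ha fun y hy => by
      rw [← hspan] at hy
      exact hB.isRefl _ _ (apply_eq_zero_of_mem_span_pair (hB.self_eq_zero a)
        (hB.isRefl _ _ hab) hy)
    rw [ha0] at hac
    simp at hac
  have h3 := SimpleGraph.two_lt_edist_iff.mpr ⟨hne, hnadj, hcommon⟩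
  refine le_trans ?_ (SimpleGraph.edist_le_ediam (u := plane hB hef0) (v := plane hB hef'))
  exact Order.add_one_le_of_lt h3

/-! ### Forms of rank four -/

/-- The space is S + T' plus the radical, and orthogonality to S removes the S-component; so T lies
in T' plus the radical. -/
theorem adj_of_adj_of_rank_four (hB : B.IsAlt)
    (hV : finrank K V = 4 + finrank K (LinearMap.ker B)) {S T T' R : Hyperbolic B}
    (h1 : (orthogonalityGraph B hB).Adj S T) (h2 : (orthogonalityGraph B hB).Adj S T')
    (h3 : (orthogonalityGraph B hB).Adj T' R) : (orthogonalityGraph B hB).Adj T R := by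
  have hW := restrict_sup_nondegenerate hB S.2.2 T'.2.2 h2
  have hker := orthogonal_eq_ker hB hW (by rw [Hyperbolic.finrank_sup h2, hV])
  have htop := (LinearMap.BilinForm.isCompl_orthogonal_of_restrict_nondegenerate
    hB.isRefl hW).sup_eq_top
  intro t ht z hz
  have ht' : t ∈ (S.1 ⊔ T'.1) ⊔ B.orthogonal (S.1 ⊔ T'.1) := htop ▸ mem_top
  obtain ⟨w, hw, k, hk, rfl⟩ := mem_sup.mp ht'
  obtain ⟨s, hs, t', ht'', rfl⟩ := mem_sup.mp hw
  rw [hker, LinearMap.mem_ker] at hk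
  have hs0 : s = 0 := eq_zero_of_restrict_nondegenerate S.2.2 hs fun y hy => by
    have := hB.isRefl _ _ (h1 y hy _ ht)
    rwa [map_add, map_add, hk, add_zero, LinearMap.add_apply, hB.isRefl _ _ (h2 y hy t' ht''),
      add_zero] at this
  rw [hs0, zero_add, map_add, hk, add_zero]
  exact h3 t' ht'' z hz

/-- Being adjacent to ⟨e, f⟩ or to ⟨a, c⟩ persists along walks, but ⟨e + a, f⟩ is adjacent to
neither. -/
theorem not_connected_of_rank_four (hB : B.IsAlt)
    (hV : finrank K V = 4 + finrank K (LinearMap.ker B)) :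
    ¬ (orthogonalityGraph B hB).Connected := by
  intro hconn
  obtain ⟨e, f, hef⟩ := exists_hyperbolic (B := B) (show finrank K (LinearMap.ker B) < _ by omega)
  obtain ⟨a, c, hac, hea, hec, hfa, hfc⟩ := exists_pair_perp hB (by omega) hef
  have hef0 : B e f ≠ 0 := hef ▸ one_ne_zero
  have hac0 : B a c ≠ 0 := hac ▸ one_ne_zero
  have hef' : B (e + a) f ≠ 0 := by simp [hef, hB.isRefl _ _ hfa]
  have hST : (orthogonalityGraph B hB).Adj (plane hB hef0) (plane hB hac0) :=
    adj_plane_plane hB _ _ hea hec hfa hfc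
  have key (U U' : Hyperbolic B) (q : (orthogonalityGraph B hB).Walk U U')
      (hU : (orthogonalityGraph B hB).Adj (plane hB hef0) U ∨
        (orthogonalityGraph B hB).Adj (plane hB hac0) U) :
      (orthogonalityGraph B hB).Adj (plane hB hef0) U' ∨
        (orthogonalityGraph B hB).Adj (plane hB hac0) U' := by
    induction q with
    | nil => exact hU
    | cons h _ ih =>
      refine ih (hU.symm.imp (fun hU => ?_) fun hU => ?_)
      · exact adj_of_adj_of_rank_four hB hV hST.symm hU h
      · exact adj_of_adj_of_rank_four hB hV hST hU h
  obtain ⟨q⟩ := hconn.preconnected (plane hB hac0) (plane hB hef')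
  rcases key _ _ q (Or.inl hST) with h | h
  · exact hef0 (h e (left_mem_plane hB _) f (right_mem_plane hB _))
  · have := hB.isRefl _ _ (h c (right_mem_plane hB _) (e + a) (left_mem_plane hB _))
    rw [map_add, LinearMap.add_apply, hec, hac, zero_add] at this
    exact one_ne_zero this

/-- The frame complex of a form of rank `2 * n` with `n ≥ 2` is connected if and only if `n ≥ 3`. -/
theorem connectedSpace_frameComplex_iff (hB : B.IsAlt) {n : ℕ} (hn : 2 ≤ n)
    (hV : finrank K V = 2 * n + finrank K (LinearMap.ker B)) :
    ConnectedSpace (Realization (frameComplex B hB)) ↔ 3 ≤ n := by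
  rw [frameComplex, connectedSpace_realization_cliqueComplex_iff]
  constructor
  · intro h
    by_contra hn3
    exact not_connected_of_rank_four hB (by omega) h
  · intro h
    exact connected_orthogonalityGraph hB (by omega)

end FiniteDimensional

end LinearAlgebra

/-! ### Graphs which are perfect matchings -/

section Matching

variable {W : Type u} {G : SimpleGraph W}

/-- Being equal or adjacent is an equivalence relation in a perfect matching. -/
def matchingSetoid (hG : ∀ v, ∃! w, G.Adj v w) : Setoid W where
  r v w := v = w ∨ G.Adj v w
  iseqv :=
    { refl := fun _ => Or.inl rfl
      symm := fun h => h.imp Eq.symm SimpleGraph.Adj.symm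
      trans := by
        rintro x y z (rfl | hxy) (rfl | hyz)
        · exact Or.inl rfl
        · exact Or.inr hyz
        · exact Or.inr hxy
        · exact Or.inl ((hG y).unique hxy.symm hyz) }

/-- A clique containing v has no elements besides v and its partner. -/
theorem exists_face_of_matching (hG : ∀ v, ∃! w, G.Adj v w) {s : Finset W}
    (hs : s ∈ (cliqueComplex G).faces) {v c : W} (hv : v ∈ s) (hc : v = c ∨ G.Adj v c) :
    ∃ t ∈ (cliqueComplex G).faces, s ⊆ t ∧ c ∈ t := by
  classical
  obtain ⟨w, hw, -⟩ := id (hG v)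
  have hmem (x : W) (hx : v = x ∨ G.Adj v x) : x ∈ ({v, w} : Finset W) := by
    rcases hx with rfl | hx
    · simp
    · simp [(hG v).unique hx hw]
  refine ⟨{v, w}, ⟨⟨v, by simp⟩, by simpa [SimpleGraph.isClique_pair] using fun _ => hw⟩,
    fun x hx => hmem x ?_, hmem c hc⟩
  by_cases hxv : v = x
  · exact Or.inl hxv
  · exact Or.inr (hs.2 hv hx hxv)

/-- The clique complex of a perfect matching is homotopy-discrete, with half as many connected
components as the graph has vertices. -/
theorem homotopyDiscrete_of_matching (hG : ∀ v, ∃! w, G.Adj v w) :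
    HomotopyDiscrete (Realization (cliqueComplex G)) ∧
      2 * Cardinal.mk (ConnectedComponents (Realization (cliqueComplex G))) = Cardinal.mk W := by
  let D := Quotient (matchingSetoid hG)
  let p : W → D := Quotient.mk (matchingSetoid hG)
  let c : D → W := Quotient.out
  let _ : TopologicalSpace D := ⊥
  have : DiscreteTopology D := ⟨rfl⟩
  have hc (d : D) : p (c d) = d := Quotient.out_eq d
  have hrel {v w : W} : p v = p w ↔ v = w ∨ G.Adj v w := Quotient.eq
  have hp : ∀ s ∈ (cliqueComplex G).faces, ∀ v ∈ s, ∀ w ∈ s, p v = p w := by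
    intro s hs v hv w hw
    refine hrel.mpr ?_
    by_cases hvw : v = w
    · exact Or.inl hvw
    · exact Or.inr (hs.2 hv hw hvw)
  have hf : ∀ s ∈ (cliqueComplex G).faces, ∀ v ∈ s,
      ∃ t ∈ (cliqueComplex G).faces, s ⊆ t ∧ c (p v) ∈ t := fun s hs v hv =>
    exists_face_of_matching hG hs hv (hrel.mp (hc (p v)).symm)
  refine ⟨⟨D, inferInstance, inferInstance,
    Realization.nonempty_homotopyEquiv_discrete p c hc hp hf⟩, ?_⟩
  obtain ⟨e⟩ := Realization.nonempty_connectedComponents_equiv p c hc hp hf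
  choose m hm hmu using id hG
  -- A class consists of its representative and the partner of that; this is the factor two.
  let φ : D × Bool → W := fun x => if x.2 then m (c x.1) else c x.1
  have hpφ (x : D × Bool) : p (φ x) = x.1 := by
    obtain ⟨d, _ | _⟩ := x
    · exact hc d
    · exact (hrel.mpr (Or.inr (hm (c d)).symm)).trans (hc d)
  have hφ : Function.Bijective φ := by
    constructor
    · rintro ⟨d, i⟩ ⟨d', i'⟩ h
      obtain rfl : d = d' := (hpφ (d, i)).symm.trans ((congrArg p h).trans (hpφ (d', i')))
      have hne := (hm (c d)).ne
      cases i <;> cases i' <;> simp_all [φ]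
    · intro w
      rcases hrel.mp (hc (p w)) with h | h
      · exact ⟨(p w, false), h⟩
      · exact ⟨(p w, true), (hmu _ _ h).symm⟩
  have h1 := Cardinal.mk_congr (Equiv.ofBijective φ hφ)
  rw [← h1, Cardinal.mk_congr e, Cardinal.mk_prod, mul_comm]
  simp

end Matching

/-! ### Counting hyperbolic planes -/

section Counting

open Module Submodule

variable {K : Type u} {V : Type v} [Field K] [AddCommGroup V] [Module K V]
  {B : LinearMap.BilinForm K V}

theorem restrict_top_nondegenerate (hB : B.IsAlt) (hBn : B.Nondegenerate) :
    (B.restrict ⊤).Nondegenerate :=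
  restrict_nondegenerate_of_left hB fun x _ h => hBn.1 x fun y => h y mem_top

theorem card_hyperbolic_eq : Nat.card (Hyperbolic B) =
    Nat.card {T : Hyperbolic B // T.1 ≤ ⊤} :=
  Nat.card_congr (Equiv.subtypeUnivEquiv fun _ => le_top).symm

variable [FiniteDimensional K V]

/-- The solutions form a translate of the hyperplane `ker (B x)`. -/
theorem card_apply_eq_one [Finite K] {x : V} (hx : B x ≠ 0) :
    Nat.card {y // B x y = 1} = Nat.card K ^ (finrank K V - 1) := by
  obtain ⟨z, hz⟩ : ∃ z, B x z ≠ 0 := by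
    by_contra! h
    exact hx (LinearMap.ext h)
  have hy : B x ((B x z)⁻¹ • z) = 1 := by simp [hz]
  generalize (B x z)⁻¹ • z = y₀ at hy
  have e : {y // B x y = 1} ≃ LinearMap.ker (B x) :=
    { toFun := fun y => ⟨y.1 - y₀, by simp [y.2, hy]⟩
      invFun := fun y => ⟨y.1 + y₀, by simp [LinearMap.mem_ker.mp y.2, hy]⟩
      left_inv := fun y => by simp
      right_inv := fun y => by simp }
  rw [Nat.card_congr e, Module.natCard_eq_pow_finrank (K := K)]
  congr 1
  have h1 := (B x).finrank_range_add_finrank_ker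
  rw [LinearMap.range_eq_top.mpr (LinearMap.surjective hx), finrank_top, finrank_self] at h1
  omega

theorem card_pairs [Finite K] (hBn : B.Nondegenerate) :
    Nat.card {p : V × V // B p.1 p.2 = 1} =
      (Nat.card K ^ finrank K V - 1) * Nat.card K ^ (finrank K V - 1) := by
  have hfin : Finite V := Module.finite_of_finite K
  have := Fintype.ofFinite V
  classical
  have e : {p : V × V // B p.1 p.2 = 1} ≃ Σ x : {x : V // x ≠ 0}, {y // B x y = 1} :=
    { toFun := fun p => ⟨⟨p.1.1, fun h => by have := p.2; rw [h] at this; simp at this⟩,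
        p.1.2, p.2⟩
      invFun := fun p => ⟨(p.1.1, p.2.1), p.2.2⟩
      left_inv := fun _ => rfl
      right_inv := fun _ => rfl }
  have h1 (x : {x : V // x ≠ 0}) :
      Nat.card {y // B x y = 1} = Nat.card K ^ (finrank K V - 1) := by
    refine card_apply_eq_one fun h => x.2 (hBn.1 x.1 fun y => ?_)
    rw [h]; rfl
  have h2 : Nat.card {x : V // x ≠ 0} = Nat.card K ^ finrank K V - 1 := by
    rw [← Module.natCard_eq_pow_finrank (K := K) (V := V)]
    simp [Fintype.card_subtype_compl]
  rw [Nat.card_congr e, Nat.card_sigma, Finset.sum_congr rfl fun x _ => h1 x, Finset.sum_const,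
    smul_eq_mul, ← h2, Finset.card_univ, Nat.card_eq_fintype_card (α := {x : V // x ≠ 0})]

/-- The hyperbolic pairs of a subspace, sorted by the planes which they span. -/
def pairsEquiv (hB : B.IsAlt) (U : Submodule K V) :
    {p : U × U // B.restrict U p.1 p.2 = 1} ≃
      Σ T : {T : Hyperbolic B // T.1 ≤ U}, {p : T.1.1 × T.1.1 // B.restrict T.1.1 p.1 p.2 = 1} where
  toFun p := by
    have h : B p.1.1.1 p.1.2.1 = 1 := p.2
    have h0 : B p.1.1.1 p.1.2.1 ≠ 0 := by rw [h]; exact one_ne_zero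
    exact ⟨⟨plane hB h0, span_le.mpr (by
      rintro z (rfl | rfl)
      exacts [p.1.1.2, p.1.2.2])⟩,
      ⟨(⟨_, left_mem_plane hB h0⟩, ⟨_, right_mem_plane hB h0⟩), h⟩⟩
  invFun p := ⟨(⟨p.2.1.1.1, p.1.2 p.2.1.1.2⟩, ⟨p.2.1.2.1, p.1.2 p.2.1.2.2⟩), p.2.2⟩
  left_inv _ := rfl
  right_inv := by
    rintro ⟨⟨T, hT⟩, ⟨⟨⟨x, hx⟩, ⟨y, hy⟩⟩, h⟩⟩
    have h' : B x y = 1 := h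
    obtain rfl := T.eq_plane hB hx hy (h' ▸ one_ne_zero)
    rfl

theorem finite_hyperbolic [Finite K] : Finite (Hyperbolic B) := by
  have hfin : Finite V := Module.finite_of_finite K
  exact Finite.of_injective (fun S : Hyperbolic B => (S.1 : Set V)) fun S T h =>
    Hyperbolic.ext (SetLike.coe_injective h)

/-- Pairs in U with form value 1 are counted twice: directly, and plane by plane, each plane having
(q² - 1)q of them. -/
theorem card_hyperbolic_le [Finite K] (hB : B.IsAlt) {U : Submodule K V}
    (hU : (B.restrict U).Nondegenerate) :
    Nat.card {T : Hyperbolic B // T.1 ≤ U} * ((Nat.card K ^ 2 - 1) * Nat.card K) =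
      (Nat.card K ^ finrank K U - 1) * Nat.card K ^ (finrank K U - 1) := by
  have hfin := finite_hyperbolic (B := B)
  have hfin' : Finite V := Module.finite_of_finite K
  have := Fintype.ofFinite {T : Hyperbolic B // T.1 ≤ U}
  rw [← card_pairs hU, Nat.card_congr (pairsEquiv hB U), Nat.card_sigma,
    Finset.sum_congr rfl fun T _ => card_pairs T.1.2.2]
  simp only [fun T : {T : Hyperbolic B // T.1 ≤ U} => T.1.2.1]
  simp

theorem two_le_card [Finite K] : 2 ≤ Nat.card K := Finite.one_lt_card

theorem card_hyperbolic_of_finrank_four [Finite K] (hB : B.IsAlt) {U : Submodule K V}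
    (hU : (B.restrict U).Nondegenerate) (h : finrank K U = 4) :
    Nat.card {T : Hyperbolic B // T.1 ≤ U} = Nat.card K ^ 2 * (Nat.card K ^ 2 + 1) := by
  have h1 := card_hyperbolic_le hB hU
  have hq := two_le_card (K := K)
  rw [h] at h1
  generalize Nat.card K = q at h1 hq ⊢
  have hq2 : 1 < q ^ 2 := Nat.one_lt_pow (by norm_num) (by omega)
  refine Nat.eq_of_mul_eq_mul_right (m := (q ^ 2 - 1) * q)
    (Nat.mul_pos (by omega) (by omega)) (h1.trans ?_)
  -- Writing q² = m + 1 turns the truncated subtractions into polynomial identities.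
  obtain ⟨m, hm⟩ : ∃ m, q ^ 2 = m + 1 := ⟨q ^ 2 - 1, by omega⟩
  have h4 : q ^ 4 - 1 = m * (m + 2) := by
    rw [show q ^ 4 = (q ^ 2) ^ 2 by ring, hm]
    exact Nat.sub_eq_of_eq_add (by ring)
  rw [h4, show q ^ (4 - 1) = q ^ 2 * q by ring, hm, Nat.add_sub_cancel]
  ring

theorem card_hyperbolic_of_finrank_six [Finite K] (hB : B.IsAlt) {U : Submodule K V}
    (hU : (B.restrict U).Nondegenerate) (h : finrank K U = 6) :
    Nat.card {T : Hyperbolic B // T.1 ≤ U} =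
      Nat.card K ^ 4 * (Nat.card K ^ 4 + Nat.card K ^ 2 + 1) := by
  have h1 := card_hyperbolic_le hB hU
  have hq := two_le_card (K := K)
  rw [h] at h1
  generalize Nat.card K = q at h1 hq ⊢
  have hq2 : 1 < q ^ 2 := Nat.one_lt_pow (by norm_num) (by omega)
  refine Nat.eq_of_mul_eq_mul_right (m := (q ^ 2 - 1) * q)
    (Nat.mul_pos (by omega) (by omega)) (h1.trans ?_)
  obtain ⟨m, hm⟩ : ∃ m, q ^ 2 = m + 1 := ⟨q ^ 2 - 1, by omega⟩
  have h6 : q ^ 6 - 1 = m * (m ^ 2 + 3 * m + 3) := by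
    rw [show q ^ 6 = (q ^ 2) ^ 3 by ring, hm]
    exact Nat.sub_eq_of_eq_add (by ring)
  rw [h6, show q ^ (6 - 1) = (q ^ 2) ^ 2 * q by ring, show q ^ 4 = (q ^ 2) ^ 2 by ring, hm,
    Nat.add_sub_cancel]
  ring

theorem card_neighbors [Finite K] (hB : B.IsAlt) (hBn : B.Nondegenerate) (hV : finrank K V = 6)
    (S : Hyperbolic B) : Nat.card {T // (orthogonalityGraph B hB).Adj S T} =
      Nat.card K ^ 2 * (Nat.card K ^ 2 + 1) := by
  simp only [adj_iff_le_orthogonal]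
  refine card_hyperbolic_of_finrank_four hB (restrict_orthogonal_nondegenerate hB hBn S.2.2) ?_
  have := finrank_add_finrank_orthogonal_of_nondegenerate hB S.2.2
  rw [S.2.1] at this
  omega

/-- The family of hyperbolic planes spanned by `e + t • a` and `f`. -/
theorem mk_le_mk_hyperbolic (hB : B.IsAlt) (hBn : B.Nondegenerate) (hV : finrank K V = 4) :
    Cardinal.lift.{v} (Cardinal.mk K) ≤ Cardinal.lift.{u} (Cardinal.mk (Hyperbolic B)) := by
  have hker : finrank K (LinearMap.ker B) = 0 := by rw [hBn.ker_eq_bot, finrank_bot]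
  obtain ⟨e, f, hef⟩ := exists_hyperbolic (B := B) (by omega)
  obtain ⟨a, c, hac, hea, hec, hfa, hfc⟩ := exists_pair_perp hB (by omega) hef
  have haf := hB.isRefl _ _ hfa
  have h (t : K) : B (e + t • a) f ≠ 0 := by simp [hef, haf]
  refine Cardinal.lift_mk_le'.mpr ⟨⟨fun t => plane hB (h t), fun t s hts => ?_⟩⟩
  have h1 : e + t • a ∈ (plane hB (h s)).1 := by
    rw [← show plane hB (h t) = plane hB (h s) from hts]
    exact left_mem_plane hB (h t)
  -- In e + ta = α(e + sa) + βf, pairing with f gives α = 1 and pairing with c gives t = αs.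
  obtain ⟨α, β, hαβ⟩ := mem_span_pair.mp h1
  have h2 := congrArg (fun x => B x f) hαβ
  have h3 := congrArg (fun x => B x c) hαβ
  simp only [map_add, map_smul, LinearMap.add_apply, LinearMap.smul_apply, hef, haf, hec, hac,
    hfc, hB.self_eq_zero, smul_eq_mul, mul_zero, mul_one, add_zero, zero_add] at h2 h3
  rw [← h3, h2, one_mul]

/-- A plane is determined by the coordinates of a chosen spanning pair, and finite powers of an
infinite cardinal do not exceed it. -/
theorem mk_hyperbolic_le (hB : B.IsAlt) [Infinite K] :
    Cardinal.lift.{u} (Cardinal.mk (Hyperbolic B)) ≤ Cardinal.lift.{v} (Cardinal.mk K) := by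
  let φ := (Module.finBasis K V).equivFun
  choose x y hxy hS using fun S : Hyperbolic B => S.exists_eq_plane hB
  have hle : Cardinal.lift.{u} (Cardinal.mk (Hyperbolic B)) ≤ Cardinal.lift.{v}
      (Cardinal.mk ((Fin (finrank K V) → K) × (Fin (finrank K V) → K))) := by
    refine Cardinal.lift_mk_le'.mpr ⟨⟨fun S => (φ (x S), φ (y S)), fun S T h => ?_⟩⟩
    obtain ⟨h1, h2⟩ := Prod.mk.inj h
    have h3 := φ.injective h1
    have h4 := φ.injective h2
    rw [hS S, hS T]
    apply Hyperbolic.ext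
    change span K {x S, y S} = span K {x T, y T}
    rw [h3, h4]
  refine hle.trans (Cardinal.lift_le.mpr ?_)
  have hinf := Cardinal.aleph0_le_mk K
  have h1 : Cardinal.mk (Fin (finrank K V) → K) ≤ Cardinal.mk K := by
    have := Cardinal.power_nat_le (n := finrank K V) hinf
    simpa using this
  rw [Cardinal.mk_prod, Cardinal.lift_id]
  exact (mul_le_mul' h1 h1).trans (Cardinal.mul_eq_self hinf).le

theorem mk_hyperbolic (hB : B.IsAlt) (hBn : B.Nondegenerate) (hV : finrank K V = 4) :
    Cardinal.lift.{u} (Cardinal.mk (Hyperbolic B)) =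
      Cardinal.lift.{v} (Cardinal.mk K ^ 2 * (Cardinal.mk K ^ 2 + 1)) := by
  rcases finite_or_infinite K with hK | hK
  · have := finite_hyperbolic (B := B)
    have h1 := card_hyperbolic_of_finrank_four hB (restrict_top_nondegenerate hB hBn)
      (by rw [finrank_top, hV])
    rw [← card_hyperbolic_eq] at h1
    have h2 : Cardinal.mk K ^ 2 * (Cardinal.mk K ^ 2 + 1) =
        ((Nat.card K ^ 2 * (Nat.card K ^ 2 + 1) : ℕ) : Cardinal) := by
      rw [← Nat.cast_card (α := K)]
      push_cast
      rfl
    rw [h2, ← Nat.cast_card (α := Hyperbolic B), h1, Cardinal.lift_natCast, Cardinal.lift_natCast]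
  · have hinf := Cardinal.aleph0_le_mk K
    have h2 : Cardinal.mk K ^ 2 = Cardinal.mk K := by
      rw [pow_two, Cardinal.mul_eq_self hinf]
    rw [h2, Cardinal.add_one_eq hinf, Cardinal.mul_eq_self hinf]
    exact le_antisymm (mk_hyperbolic_le hB) (mk_le_mk_hyperbolic hB hBn hV)

end Counting

/-! ### The frame complex in dimensions four and six -/

section Main

open Module

variable {K : Type u} {V : Type v} [Field K] [AddCommGroup V] [Module K V]
  [FiniteDimensional K V] {B : LinearMap.BilinForm K V}

theorem homotopyDiscrete_frameComplex (hB : B.IsAlt) (hBn : B.Nondegenerate)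
    (hV : finrank K V = 4) :
    HomotopyDiscrete (Realization (frameComplex B hB)) ∧
      2 * Cardinal.lift.{u}
          (Cardinal.mk (ConnectedComponents (Realization (frameComplex B hB)))) =
        Cardinal.lift.{v} (Cardinal.mk K ^ 2 * (Cardinal.mk K ^ 2 + 1)) := by
  obtain ⟨h1, h2⟩ := homotopyDiscrete_of_matching (existsUnique_adj hB hBn hV)
  refine ⟨h1, ?_⟩
  rw [← mk_hyperbolic hB hBn hV, ← h2, Cardinal.lift_mul, Cardinal.lift_ofNat]
  rfl

theorem exists_wedge_frameComplex (hB : B.IsAlt) (hBn : B.Nondegenerate) (hV : finrank K V = 6) :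
    ∃ ι : Type v, Nonempty ι ∧
      Nonempty (ContinuousMap.HomotopyEquiv
        (Realization (frameComplex B hB)) (WedgeOfCircles ι)) ∧
      (Finite K →
        (Nat.card ι : ℤ) = -reducedEulerChar (frameComplex B hB) ∧
        ∀ q : ℕ, Nat.card K = q →
          (-reducedEulerChar (frameComplex B hB) : ℚ) =
            1 / 3 * ((q : ℚ) ^ 12 + 2 * (q : ℚ) ^ 10 - (q : ℚ) ^ 8 - 2 * (q : ℚ) ^ 6
              - 3 * (q : ℚ) ^ 4 + 3)) := by
  have hker : finrank K (LinearMap.ker B) = 0 := by rw [hBn.ker_eq_bot, finrank_bot]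
  have hrank : finrank K (LinearMap.ker B) + 4 < finrank K V := by omega
  have hG := uniqueTriangles_orthogonalityGraph hB hBn hV
  have hd (S : Hyperbolic B) : ∃ T, (orthogonalityGraph B hB).Adj S T := by
    obtain ⟨T, -, hT, -⟩ := exists_two_neighbors hB hrank S
    exact ⟨T, hT⟩
  obtain ⟨ι, hequiv, hcard, hne⟩ := hG.exists_wedge hd (connected_orthogonalityGraph hB hrank)
  refine ⟨ι, hne ⟨3, fun S T => ?_⟩ fun S => ?_, hequiv, fun hK => ?_⟩
  · exact ENat.toNat_le_of_le_natCast (edist_le_three hB hrank S T)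
  -- Two non-adjacent neighbours of S lie in different triangles through S.
  · obtain ⟨T, T', hT, hT', hTT, hnadj⟩ := exists_two_neighbors hB hrank S
    obtain ⟨t, hSt, hTt⟩ := hG.exists_tri_of_adj hT
    obtain ⟨t', hSt', hTt'⟩ := hG.exists_tri_of_adj hT'
    exact ⟨t, t', fun h => hnadj (t.2.1 hTt (h ▸ hTt') hTT), hSt, hSt'⟩
  · have hfin := finite_hyperbolic (B := B)
    have hχ := hG.reducedEulerChar_eq hd
    have hι := hcard hfin
    rw [frameComplex, hχ]
    refine ⟨by omega, ?_⟩
    rintro q rfl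
    have hT := hG.card_tri (card_neighbors hB hBn hV)
    have hN := card_hyperbolic_of_finrank_six hB (restrict_top_nondegenerate hB hBn)
      (by rw [finrank_top, hV])
    rw [← card_hyperbolic_eq] at hN
    rw [hN] at hT ⊢
    have hT' := congrArg (Nat.cast : ℕ → ℚ) hT
    push_cast at hT' ⊢
    -- With N planes of degree d and t triangles, minus the Euler characteristic is 1 - N + 2t, and
    -- Nd = 6t turns 2t into Nd/3.
    linear_combination (-1 / 3) * hT'

end Main

end SymplecticFrames

end

/-! ### Assembly of the theorem. -/

open SymplecticFrames in
theorem theorem6p1 {K : Type u} [Field K] (n : ℕ) (hn : 2 ≤ n) :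
    (∀ (V : Type v) [AddCommGroup V] [Module K V] [FiniteDimensional K V]
      (B : LinearMap.BilinForm K V) (hB : B.IsAlt),
      B.Nondegenerate → Module.finrank K V = 2 * n →
        (ConnectedSpace (Realization (frameComplex B hB)) ↔ 3 ≤ n) ∧
        (n = 2 →
          HomotopyDiscrete (Realization (frameComplex B hB)) ∧
          2 * Cardinal.lift.{u}
              (Cardinal.mk (ConnectedComponents (Realization (frameComplex B hB)))) =
            Cardinal.lift.{v} (Cardinal.mk K ^ 2 * (Cardinal.mk K ^ 2 + 1))) ∧
        (n = 3 →
          (orthogonalityGraph B hB).ediam = 3 ∧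
          ∃ ι : Type v, Nonempty ι ∧
            Nonempty (ContinuousMap.HomotopyEquiv
              (Realization (frameComplex B hB)) (WedgeOfCircles ι)) ∧
            (Finite K →
              (Nat.card ι : ℤ) = -reducedEulerChar (frameComplex B hB) ∧
              ∀ q : ℕ, Nat.card K = q →
                (-reducedEulerChar (frameComplex B hB) : ℚ) =
                  1 / 3 * ((q : ℚ) ^ 12 + 2 * (q : ℚ) ^ 10 - (q : ℚ) ^ 8 - 2 * (q : ℚ) ^ 6
                    - 3 * (q : ℚ) ^ 4 + 3))) ∧
        (4 ≤ n → (orthogonalityGraph B hB).ediam = 2)) ∧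
    (∀ (V' : Type v) [AddCommGroup V'] [Module K V'] [FiniteDimensional K V']
      (B : LinearMap.BilinForm K V') (hB : B.IsAlt) (r : ℕ),
      Module.finrank K (LinearMap.ker B) = r → Module.finrank K V' = 2 * n + r →
        (ConnectedSpace (Realization (frameComplex B hB)) ↔ 3 ≤ n)) := by
  refine ⟨fun V _ _ _ B hB hBn hV => ⟨?_, fun h2 => ?_, fun h3 => ?_, fun h4 => ?_⟩,
    fun V' _ _ _ B hB r hr hV => connectedSpace_frameComplex_iff hB hn (by rw [hr, hV])⟩
  · exact connectedSpace_frameComplex_iff hB hn (by rw [hBn.ker_eq_bot, finrank_bot, hV, add_zero])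
  · exact homotopyDiscrete_frameComplex hB hBn (by rw [hV, h2])
  · exact ⟨ediam_eq_three hB hBn (by rw [hV, h3]),
      exists_wedge_frameComplex hB hBn (by rw [hV, h3])⟩
  · exact ediam_eq_two hB hBn (by omega)
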